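/- Let $(\Xi,\mathcal D)$ be a probability space, $f:\mathbb R^d\times\Xi\to\mathbb R$ with $f(\cdot,\xi)$ differentiable for almost every $\xi$, $f(x,\cdot)$ integrable for every $x$ and $(x,\xi)\mapsto\nabla f(x,\xi)$ (gradient in $x$) jointly measurable, and let $F(x)=\mathbb E_{\xi\sim\mathcal D}[f(x,\xi)]$. Let $\sigma>0$, $\beta\ge 0$, $\widehat G\ge 0$, and assume that (1) $F^*:=\inf_x F(x)>-\infty$; (2) $F$ is differentiable and, for all $x$, $\mathbb E[\nabla f(x,\xi)]=\nabla F(x)$ and $\mathbb E\|\nabla f(x,\xi)-\nabla F(x)\|^2\le\sigma^2$; (3) $\mathbb E\|\nabla f(x,\xi)-\nabla f(y,\xi)\|^2\le\beta^2\|x-y\|^2$ for all $x,y$; (4) for $\mathcal D$-almost every $\xi$, $\|\nabla f(x,\xi)\|\le\widehat G$ for all $x$. Let $x_1\in\mathbb R^d$, let $\xi_1,\xi_2,\dots$ be i.i.d. with law $\mathcal D$, put $d_1=\nabla f(x_1,\xi_1)$ and, for $t\ge 1$, $$a_{t+1}=\Big(1+\sum_{i=1}^t\|\nabla f(x_i,\xi_i)\|^2\Big)^{-2/3},\qquad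 b_t=\Big(1+\sum_{i=1}^t\|d_i\|^2\Big)^{1/2}\Big/a_{t+1}^{1/4},\qquad x_{t+1}=x_t-\frac1{b_t}d_t,$$ $$d_{t+1}=\nabla f(x_{t+1},\xi_{t+1})+(1-a_{t+1})\big(d_t-\nabla f(x_t,\xi_{t+1})\big).$$ (This is META-STORM-SG with $p=\frac12$, $q=\frac14$, $a_0=b_0=\eta=1$.) Let $x_{\mathrm{out}}=x_\tau$ with $\tau$ uniform on $\{1,\dots,T\}$ and independent of $(\xi_t)_t$. Put $$\kappa_2=(1+\widehat G^2)\max\{\beta,1\},\qquad \kappa_1=F(x_1)-F^*+\sigma^2+\widehat G^2+\kappa_2\log\kappa_2 .$$ There are absolute constants $C_0,C>0$ (depending on nothing, in particular not on $d$, $f$, $\mathcal D$, $\sigma$, $\beta$, $\widehat G$, $x_1$, $T$, $\delta$) such that, whenever $T$ is large enough in the sense that $(\sigma^2T)^{1/3}\ge C_0(1+\kappa_1)$, for every $0<\delta<1$, with probability at least $1-\delta$, $$\|\nabla F(x_{\mathrm{out}})\|\le C\,\frac{\kappa_1+\kappa_2\log(1+\sigma^2T)}{\delta^{3/2}}\Big(\frac1{T^{1/2}}+\frac{\sigma^{1/3}}{T^{1/3}}\Big).$$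 -/

import Mathlib

open MeasureTheory ProbabilityTheory

noncomputable section

namespace MetaStorm

/-- The objective `F(x) = E_{ξ ∼ μ}[f(x, ξ)]`. -/
def objective {d : ℕ} {Ξ : Type*} [MeasurableSpace Ξ]
    (f : EuclideanSpace ℝ (Fin d) → Ξ → ℝ) (μ : Measure Ξ)
    (x : EuclideanSpace ℝ (Fin d)) : ℝ :=
  ∫ ξ, f x ξ ∂μ

/-- The stochastic gradient `∇f(x, ξ)`, the gradient in the variable `x`. -/
def stochGrad {d : ℕ} {Ξ : Type*} (f : EuclideanSpace ℝ (Fin d) → Ξ → ℝ)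
    (x : EuclideanSpace ℝ (Fin d)) (ξ : Ξ) : EuclideanSpace ℝ (Fin d) :=
  gradient (fun y => f y ξ) x

/-- The assumptions on the stochastic problem. The first three fields only say that the
objective and the stochastic gradients are well defined. -/
structure Assumptions {d : ℕ} {Ξ : Type*} [MeasurableSpace Ξ]
    (f : EuclideanSpace ℝ (Fin d) → Ξ → ℝ) (μ : Measure Ξ) (σ β G : ℝ) : Prop where
  integrable : ∀ x, Integrable (f x) μ
  differentiable : ∀ᵐ ξ ∂μ, Differentiable ℝ (fun x => f x ξ)
  measurable_stochGrad :
    Measurable (fun z : EuclideanSpace ℝ (Fin d) × Ξ => stochGrad f z.1 z.2)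
  /-- The objective is bounded below. -/
  bddBelow : BddBelow (Set.range (objective f μ))
  /-- `F` is differentiable and `E[∇f(x, ξ)] = ∇F(x)`. -/
  unbiased : ∀ x, HasGradientAt (objective f μ) (∫ ξ, stochGrad f x ξ ∂μ) x
  /-- Variance at most `σ²`. -/
  variance_le : ∀ x, ∫ ξ, ‖stochGrad f x ξ - gradient (objective f μ) x‖ ^ 2 ∂μ ≤ σ ^ 2
  /-- Averaged `β`-smoothness. -/
  smooth : ∀ x y, ∫ ξ, ‖stochGrad f x ξ - stochGrad f y ξ‖ ^ 2 ∂μ ≤ β ^ 2 * ‖x - y‖ ^ 2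
  /-- Bounded stochastic gradients. -/
  bounded : ∀ᵐ ξ ∂μ, ∀ x, ‖stochGrad f x ξ‖ ≤ G

/-- What the algorithm knows in round `t`, after the sample `ξ_t` has been drawn. -/
structure State (d : ℕ) where
  /-- the iterate `x_t` -/
  x : EuclideanSpace ℝ (Fin d)
  /-- the gradient estimate `d_t` -/
  dir : EuclideanSpace ℝ (Fin d)
  /-- `∑_{i ≤ t} ‖∇f(x_i, ξ_i)‖²` -/
  sumGrad : ℝ
  /-- `∑_{i ≤ t} ‖d_i‖²` -/
  sumDir : ℝ

/-- The momentum parameter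
`a_{t+1} = (1 + ∑_{i ≤ t} ‖∇f(x_i, ξ_i)‖² / a₀²)^{-2/3}`, read off the state of round `t`. -/
def State.a {d : ℕ} (s : State d) (a₀ : ℝ) : ℝ :=
  (1 + s.sumGrad / a₀ ^ 2) ^ (-(2 / 3) : ℝ)

/-- `b_t = (b₀^{1/p} + ∑_{i ≤ t} ‖d_i‖²)^p / a_{t+1}^q`, read off the state of round `t`. -/
def State.b {d : ℕ} (s : State d) (a₀ b₀ p q : ℝ) : ℝ :=
  (b₀ ^ (1 / p) + s.sumDir) ^ p / s.a a₀ ^ q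

/-- The next iterate `x_{t+1} = x_t - (η / b_t) d_t`. -/
def State.nextX {d : ℕ} (s : State d) (a₀ b₀ η p q : ℝ) : EuclideanSpace ℝ (Fin d) :=
  s.x - (η / s.b a₀ b₀ p q) • s.dir

/-- The next estimate
`d_{t+1} = ∇f(x_{t+1}, ξ_{t+1}) + (1 - a_{t+1}) (d_t - ∇f(x_t, ξ_{t+1}))`. -/
def State.nextDir {d : ℕ} {Ξ : Type*}
    (g : EuclideanSpace ℝ (Fin d) → Ξ → EuclideanSpace ℝ (Fin d))
    (s : State d) (a₀ b₀ η p q : ℝ) (ξ : Ξ) : EuclideanSpace ℝ (Fin d) :=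
  g (s.nextX a₀ b₀ η p q) ξ + (1 - s.a a₀) • (s.dir - g s.x ξ)

/-- The algorithm META-STORM-SG, with gradient oracle `g`, initial point `x₁` and samples
`ξ 0, ξ 1, …`. Rounds are counted from `0`: the state with index `n` is that of round
`n + 1`, and `ξ n` is the sample of round `n + 1`. -/
def metaStormSG {d : ℕ} {Ξ : Type*}
    (g : EuclideanSpace ℝ (Fin d) → Ξ → EuclideanSpace ℝ (Fin d))
    (a₀ b₀ η p q : ℝ) (x₁ : EuclideanSpace ℝ (Fin d)) (ξ : ℕ → Ξ) : ℕ → State d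
  | 0 =>
    { x := x₁
      dir := g x₁ (ξ 0)
      sumGrad := ‖g x₁ (ξ 0)‖ ^ 2
      sumDir := ‖g x₁ (ξ 0)‖ ^ 2 }
  | n + 1 =>
    let s := metaStormSG g a₀ b₀ η p q x₁ ξ n
    { x := s.nextX a₀ b₀ η p q
      dir := s.nextDir g a₀ b₀ η p q (ξ (n + 1))
      sumGrad := s.sumGrad + ‖g (s.nextX a₀ b₀ η p q) (ξ (n + 1))‖ ^ 2
      sumDir := s.sumDir + ‖s.nextDir g a₀ b₀ η p q (ξ (n + 1))‖ ^ 2 }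

/-- `κ₂ = (1 + G²) max(β, 1)`. -/
def kappa₂ (β G : ℝ) : ℝ := (1 + G ^ 2) * max β 1

/-- `κ₁ = Δ + σ² + G² + κ₂ log κ₂`, where `Δ` stands for `F(x₁) - F*`. -/
def kappa₁ (Δ σ β G : ℝ) : ℝ :=
  Δ + σ ^ 2 + G ^ 2 + kappa₂ β G * Real.log (kappa₂ β G)

end MetaStorm

end

/-! Write r for `State.root`, D for `State.rad`, g for the stochastic gradients along the run and
err for the error of the estimate d. Then a = r⁻⁴ and b = D r. Put U = r², X = D / r, Y = Σ ‖errᵢ‖²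
/ rᵢ². Since ∇F differs from d by err and r is nondecreasing, H = Σ ‖∇F(xᵢ)‖² satisfies H ≤ 2 U (X²
+ Y) on every path (`sumSqGradient_le`). The factors are dependent and only their first moments are
controlled, so this product of degree three is linearised under a cube root (`rpow_third_le_of_le`).

Bound for X: in the descent lemma the term ⟨err, d⟩ is split by Young's inequality with parameter
κ₂, leaving Y / (2κ₂) and κ₂ log(1 + Σ‖d‖²), up to constants (`descent_sum`). Bound for Y: the
squared error contracts by 1 − a in conditional mean. Multiplied by a weight of order a^(-1/2), it
loses a multiple of ‖err‖² / r² per round, up to terms with logarithmic sums and up to `excess`,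
whose conditional mean is nonpositive (`weighted_sum`, `integral_sum_err_le`). Since log(1 + Σ‖d‖²)
= 2 log X + log(1 + Σ‖g‖²) / 3, concavity of log closes the loop: E X ≤ 14 B and E Y ≤ 24 B², where
B is a constant plus κ₂ E log(1 + Σ‖g‖²) (`integral_moments_le`).

Bound for U: splitting g into gradient and noise gives E U ≤ 1 + 2h + 4S with h = E H^(1/3) and S³ =
σ²T (`integral_root_sq_le`). Thus h is at most a multiple of ((1 + 2h + 4S) B²)^(1/3), while B is
only logarithmic in h. For S ≥ 10 (1 + κ₁) this forces h³ to be of order (κ₁ + κ₂ log(1 + σ²T))² S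
(`self_bounding_solution`).

Finally, the fraction of rounds with ‖∇F‖ > R is at most its own cube root, hence at most (H / (T
R²))^(1/3). Its mean is at most δ once h³ ≤ δ³ T R², which is the origin of δ^(3/2). An independent
uniform output round turns this mean into a probability. -/

noncomputable section

namespace MetaStorm

section

/-! ### Descent lemma for Lipschitz gradients. -/

section Descent

variable {E : Type*} [NormedAddCommGroup E] [InnerProductSpace ℝ E] [CompleteSpace E]

/-- Quadratic upper bound for a function with Lipschitz gradient (with constant `β` in place of
the optimal `β / 2`). -/
theorem le_add_inner_add_of_lipschitz_gradient {F : E → ℝ} {F' : E → E} {β : ℝ} (hβ : 0 ≤ β)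
    (hF : ∀ x, HasGradientAt F (F' x) x) (hL : ∀ x y, ‖F' x - F' y‖ ≤ β * ‖x - y‖) (x v : E) :
    F (x + v) ≤ F x + inner ℝ (F' x) v + β * ‖v‖ ^ 2 := by
  have hder : ∀ t : ℝ, HasDerivAt (fun t : ℝ => F (x + t • v)) (inner ℝ (F' (x + t • v)) v) t := by
    intro t
    have h1 : HasDerivAt (fun t : ℝ => x + t • v) v t := by
      simpa using ((hasDerivAt_id t).smul_const v).const_add x
    have h2 := (hF (x + t • v)).hasFDerivAt.comp_hasDerivAt t h1
    rwa [InnerProductSpace.toDual_apply_apply] at h2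
  -- A single intermediate point suffices; integrating along the segment would only gain the factor
  -- 1/2.
  obtain ⟨c, hc, hc'⟩ := exists_hasDerivAt_eq_slope (fun t : ℝ => F (x + t • v))
    (fun t => inner ℝ (F' (x + t • v)) v) zero_lt_one
    (fun t _ => (hder t).continuousAt.continuousWithinAt) (fun t _ => hder t)
  have h3 : F (x + v) - F x = inner ℝ (F' (x + c • v)) v := by simpa using hc'.symm
  have h4 : inner ℝ (F' (x + c • v)) v = inner ℝ (F' x) v + inner ℝ (F' (x + c • v) - F' x) v := by
    rw [inner_sub_left]; ring
  have h5 : inner ℝ (F' (x + c • v) - F' x) v ≤ β * ‖v‖ ^ 2 := by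
    refine (real_inner_le_norm _ _).trans ?_
    have h6 : ‖F' (x + c • v) - F' x‖ ≤ β * ‖v‖ := by
      refine (hL _ _).trans (mul_le_mul_of_nonneg_left ?_ hβ)
      rw [add_sub_cancel_left, norm_smul, Real.norm_of_nonneg hc.1.le]
      exact mul_le_of_le_one_left (norm_nonneg _) hc.2.le
    calc _ ≤ β * ‖v‖ * ‖v‖ := mul_le_mul_of_nonneg_right h6 (norm_nonneg _)
      _ = _ := by ring
  linarith

end Descent

/-- This is 1 − 1/z ≤ log z at z = y / x. It makes the adaptive sums telescope into logarithms. -/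
theorem sub_div_le_log_div {x y : ℝ} (hx : 0 < x) (hy : 0 < y) :
    (y - x) / y ≤ Real.log y - Real.log x := by
  have h := Real.one_sub_inv_le_log_of_pos (div_pos hy hx)
  rw [Real.log_div hy.ne' hx.ne', inv_div] at h
  rwa [sub_div, div_self hy.ne']

/-- Tangent line of log at c. With c free it replaces Jensen's inequality after integration. -/
theorem log_le_div_add_log {x c : ℝ} (hx : 0 < x) (hc : 0 < c) :
    Real.log x ≤ x / c + Real.log c - 1 := by
  have h := Real.log_le_sub_one_of_pos (div_pos hx hc)
  rw [Real.log_div hx.ne' hc.ne'] at h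
  linarith

/-! ### Parameters and invariants of a state. -/

variable {d : ℕ} {Ξ : Type*}

/-- The sixth root of `1 + ∑ ‖∇f(x_i, ξ_i)‖²`; the parameters are rational functions of it. -/
def State.root (s : State d) : ℝ := (1 + s.sumGrad) ^ (1 / 6 : ℝ)

/-- The square root of `1 + ∑ ‖d_i‖²`. -/
def State.rad (s : State d) : ℝ := Real.sqrt (1 + s.sumDir)

/-- One round of the algorithm with `a₀ = b₀ = η = 1`, `p = 1/2`, `q = 1/4`. -/
def State.step (g : EuclideanSpace ℝ (Fin d) → Ξ → EuclideanSpace ℝ (Fin d))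
    (s : State d) (e : Ξ) : State d where
  x := s.nextX 1 1 1 (1 / 2) (1 / 4)
  dir := s.nextDir g 1 1 1 (1 / 2) (1 / 4) e
  sumGrad := s.sumGrad + ‖g (s.nextX 1 1 1 (1 / 2) (1 / 4)) e‖ ^ 2
  sumDir := s.sumDir + ‖s.nextDir g 1 1 1 (1 / 2) (1 / 4) e‖ ^ 2

/-- The algorithm with `a₀ = b₀ = η = 1`, `p = 1/2`, `q = 1/4`. -/
def run (g : EuclideanSpace ℝ (Fin d) → Ξ → EuclideanSpace ℝ (Fin d))
    (x₁ : EuclideanSpace ℝ (Fin d)) (w : ℕ → Ξ) (n : ℕ) : State d :=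
  metaStormSG g 1 1 1 (1 / 2) (1 / 4) x₁ w n

/-- The sums accumulated in a state are nonnegative. -/
structure State.Valid (s : State d) : Prop where
  sumGrad_nonneg : 0 ≤ s.sumGrad
  sumDir_nonneg : 0 ≤ s.sumDir

namespace State

variable {s : State d}

theorem Valid.one_le_root (hs : s.Valid) : 1 ≤ s.root :=
  Real.one_le_rpow (by linarith [hs.sumGrad_nonneg]) (by norm_num)

theorem Valid.root_pos (hs : s.Valid) : 0 < s.root := one_pos.trans_le hs.one_le_root

theorem Valid.root_pow_six (hs : s.Valid) : s.root ^ 6 = 1 + s.sumGrad := by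
  rw [root, ← Real.rpow_natCast, ← Real.rpow_mul (by linarith [hs.sumGrad_nonneg])]
  norm_num

theorem Valid.rad_sq (hs : s.Valid) : s.rad ^ 2 = 1 + s.sumDir :=
  Real.sq_sqrt (by linarith [hs.sumDir_nonneg])

theorem Valid.one_le_rad (hs : s.Valid) : 1 ≤ s.rad :=
  Real.one_le_sqrt.2 (by linarith [hs.sumDir_nonneg])

theorem Valid.rad_pos (hs : s.Valid) : 0 < s.rad := one_pos.trans_le hs.one_le_rad

theorem Valid.a_eq (hs : s.Valid) : s.a 1 = (s.root ^ 4)⁻¹ := by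
  have h : 0 ≤ 1 + s.sumGrad := by linarith [hs.sumGrad_nonneg]
  rw [a, root, ← Real.rpow_natCast ((1 + s.sumGrad) ^ (1 / 6 : ℝ)) 4, ← Real.rpow_mul h,
    ← Real.rpow_neg h]
  norm_num

theorem Valid.b_eq (hs : s.Valid) : s.b 1 1 (1 / 2) (1 / 4) = s.rad * s.root := by
  have h : 0 ≤ 1 + s.sumGrad := by linarith [hs.sumGrad_nonneg]
  rw [b, a, root, rad, Real.sqrt_eq_rpow, ← Real.rpow_mul (by simpa using h), div_eq_mul_inv,
    ← Real.rpow_neg (by simpa using h)]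
  norm_num

theorem Valid.nextX_eq (hs : s.Valid) :
    s.nextX 1 1 1 (1 / 2) (1 / 4) = s.x - (s.rad * s.root)⁻¹ • s.dir := by
  rw [nextX, hs.b_eq, one_div]

theorem Valid.step {g : EuclideanSpace ℝ (Fin d) → Ξ → EuclideanSpace ℝ (Fin d)}
    (hs : s.Valid) (e : Ξ) : (s.step g e).Valid :=
  ⟨add_nonneg hs.1 (by positivity), add_nonneg hs.2 (by positivity)⟩

end State

/-! ### Monotonicity and adaptive sums along a run. -/

section Run

variable (g : EuclideanSpace ℝ (Fin d) → Ξ → EuclideanSpace ℝ (Fin d))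
  (x₁ : EuclideanSpace ℝ (Fin d)) (w : ℕ → Ξ)

theorem run_valid (n : ℕ) : (run g x₁ w n).Valid := by
  induction n with
  | zero => exact ⟨sq_nonneg _, sq_nonneg _⟩
  | succ n ih => exact ih.step _

theorem run_succ_sumGrad (n : ℕ) : (run g x₁ w (n + 1)).sumGrad =
    (run g x₁ w n).sumGrad + ‖g (run g x₁ w (n + 1)).x (w (n + 1))‖ ^ 2 := rfl

theorem run_succ_sumDir (n : ℕ) : (run g x₁ w (n + 1)).sumDir =
    (run g x₁ w n).sumDir + ‖(run g x₁ w (n + 1)).dir‖ ^ 2 := rfl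

theorem run_sumGrad (n : ℕ) : (run g x₁ w n).sumGrad =
    ∑ i ∈ Finset.range (n + 1), ‖g (run g x₁ w i).x (w i)‖ ^ 2 := by
  induction n with
  | zero => simp [run, metaStormSG]
  | succ n ih => rw [run_succ_sumGrad, ih, Finset.sum_range_succ _ (n + 1)]

theorem run_sumDir (n : ℕ) : (run g x₁ w n).sumDir =
    ∑ i ∈ Finset.range (n + 1), ‖(run g x₁ w i).dir‖ ^ 2 := by
  induction n with
  | zero => simp [run, metaStormSG]
  | succ n ih => rw [run_succ_sumDir, ih, Finset.sum_range_succ _ (n + 1)]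

theorem run_sumGrad_mono : Monotone fun n => (run g x₁ w n).sumGrad :=
  monotone_nat_of_le_succ fun n => by
    rw [run_succ_sumGrad]; exact le_add_of_nonneg_right (sq_nonneg _)

theorem run_sumDir_mono : Monotone fun n => (run g x₁ w n).sumDir :=
  monotone_nat_of_le_succ fun n => by
    rw [run_succ_sumDir]; exact le_add_of_nonneg_right (sq_nonneg _)

theorem run_root_mono : Monotone fun n => (run g x₁ w n).root := fun i j hij =>
  Real.rpow_le_rpow (by linarith [(run_valid g x₁ w i).1])
    (by have := run_sumGrad_mono g x₁ w hij; simp only at this; linarith) (by norm_num)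

theorem run_rad_mono : Monotone fun n => (run g x₁ w n).rad := fun i j hij =>
  Real.sqrt_le_sqrt (by have := run_sumDir_mono g x₁ w hij; simp only at this; linarith)

/-- Each increment is divided by a sum that already contains it, so no bound on the increments is
needed. -/
theorem sum_dir_div_le_log (n : ℕ) :
    ∑ i ∈ Finset.range (n + 1), ‖(run g x₁ w i).dir‖ ^ 2 / (1 + (run g x₁ w i).sumDir) ≤
      Real.log (1 + (run g x₁ w n).sumDir) := by
  induction n with
  | zero =>
    have h := (run_valid g x₁ w 0).2
    have h1 := sub_div_le_log_div one_pos (show 0 < 1 + (run g x₁ w 0).sumDir by linarith)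
    rw [Real.log_one, sub_zero, add_sub_cancel_left] at h1
    simpa [run_sumDir] using h1
  | succ n ih =>
    rw [Finset.sum_range_succ]
    have h := (run_valid g x₁ w n).2
    have h' := (run_valid g x₁ w (n + 1)).2
    have h1 := sub_div_le_log_div (show 0 < 1 + (run g x₁ w n).sumDir by linarith)
      (show 0 < 1 + (run g x₁ w (n + 1)).sumDir by linarith)
    have h2 : 1 + (run g x₁ w (n + 1)).sumDir - (1 + (run g x₁ w n).sumDir) =
      ‖(run g x₁ w (n + 1)).dir‖ ^ 2 := by rw [run_succ_sumDir]; ring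
    rw [h2] at h1
    linarith

/-- The denominator lags one round behind the numerator, because the momentum parameter is fixed
before the next sample. One round multiplies the denominator by at most 1 + G², which pays for the
lag. -/
theorem sum_grad_div_le_log {G : ℝ} (hw : ∀ n x, ‖g x (w n)‖ ≤ G) (n : ℕ) :
    ∑ i ∈ Finset.range (n + 1),
        ‖g (run g x₁ w (i + 1)).x (w (i + 1))‖ ^ 2 / (1 + (run g x₁ w i).sumGrad) ≤
      (1 + G ^ 2) * Real.log (1 + (run g x₁ w (n + 1)).sumGrad) := by
  have key : ∀ i, ‖g (run g x₁ w (i + 1)).x (w (i + 1))‖ ^ 2 / (1 + (run g x₁ w i).sumGrad) ≤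
      (1 + G ^ 2) * (Real.log (1 + (run g x₁ w (i + 1)).sumGrad) -
        Real.log (1 + (run g x₁ w i).sumGrad)) := by
    intro i
    have h := (run_valid g x₁ w i).1
    have h' := (run_valid g x₁ w (i + 1)).1
    have h1 := sub_div_le_log_div (show 0 < 1 + (run g x₁ w i).sumGrad by linarith)
      (show 0 < 1 + (run g x₁ w (i + 1)).sumGrad by linarith)
    have hg : ‖g (run g x₁ w (i + 1)).x (w (i + 1))‖ ^ 2 ≤ G ^ 2 :=
      pow_le_pow_left₀ (norm_nonneg _) (hw _ _) 2
    refine le_trans ?_ (mul_le_mul_of_nonneg_left h1 (by positivity))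
    rw [run_succ_sumGrad] at h' ⊢
    set u := ‖g (run g x₁ w (i + 1)).x (w (i + 1))‖ ^ 2
    have hu : 0 ≤ u := sq_nonneg _
    rw [show 1 + ((run g x₁ w i).sumGrad + u) - (1 + (run g x₁ w i).sumGrad) = u by ring,
      mul_div_assoc', div_le_div_iff₀ (by linarith) (by linarith)]
    have : 1 + ((run g x₁ w i).sumGrad + u) ≤ (1 + G ^ 2) * (1 + (run g x₁ w i).sumGrad) := by
      nlinarith [mul_nonneg (sq_nonneg G) h]
    nlinarith
  refine (Finset.sum_le_sum fun i _ => key i).trans ?_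
  rw [← Finset.mul_sum, Finset.sum_range_sub (fun i => Real.log (1 + (run g x₁ w i).sumGrad))]
  refine mul_le_mul_of_nonneg_left ?_ (by positivity)
  have := Real.log_nonneg (show 1 ≤ 1 + (run g x₁ w 0).sumGrad by
    linarith [(run_valid g x₁ w 0).1])
  linarith

end Run

/-! ### Pathwise descent estimate. -/

section Path

variable {g : EuclideanSpace ℝ (Fin d) → Ξ → EuclideanSpace ℝ (Fin d)}
  {F : EuclideanSpace ℝ (Fin d) → ℝ}
  {F' : EuclideanSpace ℝ (Fin d) → EuclideanSpace ℝ (Fin d)} {β κ : ℝ}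

/-- Writing ∇F as d minus the error separates progress from error. The step length is 1 / (rad ·
root); Young's inequality gives the factor 1 / root to the error and 1 / rad to the direction, so
that the direction terms have a logarithmic sum. -/
theorem descent_step (hβ : 0 ≤ β) (hκ : 0 < κ)
    (hF : ∀ x, HasGradientAt F (F' x) x) (hL : ∀ x y, ‖F' x - F' y‖ ≤ β * ‖x - y‖)
    {s : State d} (hs : s.Valid) :
    F (s.nextX 1 1 1 (1 / 2) (1 / 4)) ≤ F s.x - ‖s.dir‖ ^ 2 / (s.rad * s.root) +
      ‖s.dir - F' s.x‖ ^ 2 / s.root ^ 2 / (2 * κ) +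
      (κ / 2 + β) * (‖s.dir‖ ^ 2 / (1 + s.sumDir)) := by
  have hr := hs.one_le_root
  have hr0 := hs.root_pos
  have hq := hs.rad_pos
  have h := le_add_inner_add_of_lipschitz_gradient hβ hF hL s.x (-((s.rad * s.root)⁻¹ • s.dir))
  rw [← sub_eq_add_neg, ← hs.nextX_eq] at h
  have h1 : inner ℝ (F' s.x) (-((s.rad * s.root)⁻¹ • s.dir)) = -(‖s.dir‖ ^ 2 / (s.rad * s.root)) +
      (s.rad * s.root)⁻¹ * inner ℝ (s.dir - F' s.x) s.dir := by
    rw [inner_neg_right, inner_smul_right, inner_sub_left, real_inner_self_eq_norm_sq]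
    ring
  have h2 : (s.rad * s.root)⁻¹ * inner ℝ (s.dir - F' s.x) s.dir ≤
      ‖s.dir - F' s.x‖ ^ 2 / s.root ^ 2 / (2 * κ) + κ / 2 * (‖s.dir‖ ^ 2 / (1 + s.sumDir)) := by
    rw [← hs.rad_sq]
    have h3 := mul_le_mul_of_nonneg_left (real_inner_le_norm (s.dir - F' s.x) s.dir)
      (inv_nonneg.2 (mul_pos hq hr0).le)
    refine h3.trans ?_
    have h4 : ‖s.dir - F' s.x‖ ^ 2 / s.root ^ 2 / (2 * κ) + κ / 2 * (‖s.dir‖ ^ 2 / s.rad ^ 2) -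
        (s.rad * s.root)⁻¹ * (‖s.dir - F' s.x‖ * ‖s.dir‖) =
        (‖s.dir - F' s.x‖ / s.root - κ * ‖s.dir‖ / s.rad) ^ 2 / (2 * κ) := by
      field_simp
      ring
    have h5 : 0 ≤ (‖s.dir - F' s.x‖ / s.root - κ * ‖s.dir‖ / s.rad) ^ 2 / (2 * κ) := by positivity
    linarith
  have h6 : ‖-((s.rad * s.root)⁻¹ • s.dir)‖ ^ 2 ≤ ‖s.dir‖ ^ 2 / (1 + s.sumDir) := by
    rw [← hs.rad_sq, norm_neg, norm_smul, mul_pow, Real.norm_of_nonneg (by positivity), mul_inv,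
      mul_pow, div_eq_mul_inv]
    have h7 : s.root⁻¹ ^ 2 ≤ 1 := pow_le_one₀ (by positivity) (inv_le_one_of_one_le₀ hr)
    rw [inv_pow s.rad]
    have h8 : (0 : ℝ) ≤ (s.rad ^ 2)⁻¹ * ‖s.dir‖ ^ 2 := by positivity
    nlinarith
  have h9 := mul_le_mul_of_nonneg_left h6 hβ
  rw [h1] at h
  linarith

theorem descent_sum (hβ : 0 ≤ β) (hκ : 0 < κ)
    (hF : ∀ x, HasGradientAt F (F' x) x) (hL : ∀ x y, ‖F' x - F' y‖ ≤ β * ‖x - y‖)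
    {Fmin : ℝ} (hmin : ∀ x, Fmin ≤ F x)
    (x₁ : EuclideanSpace ℝ (Fin d)) (w : ℕ → Ξ) (n : ℕ) :
    (run g x₁ w n).rad / (run g x₁ w n).root ≤ 1 + (F x₁ - Fmin) +
      (∑ i ∈ Finset.range (n + 1), ‖(run g x₁ w i).dir - F' (run g x₁ w i).x‖ ^ 2 /
        (run g x₁ w i).root ^ 2) / (2 * κ) +
      (κ / 2 + β) * Real.log (1 + (run g x₁ w n).sumDir) := by
  have h1 : ∀ N, ∑ i ∈ Finset.range N, ‖(run g x₁ w i).dir‖ ^ 2 /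
        ((run g x₁ w i).rad * (run g x₁ w i).root) ≤ F x₁ - F (run g x₁ w N).x +
      (∑ i ∈ Finset.range N, ‖(run g x₁ w i).dir - F' (run g x₁ w i).x‖ ^ 2 /
        (run g x₁ w i).root ^ 2) / (2 * κ) +
      (κ / 2 + β) * ∑ i ∈ Finset.range N,
        ‖(run g x₁ w i).dir‖ ^ 2 / (1 + (run g x₁ w i).sumDir) := by
    intro N
    induction N with
    | zero => simp [run, metaStormSG]
    | succ N ih =>
      rw [Finset.sum_range_succ, Finset.sum_range_succ, Finset.sum_range_succ]
      have h := descent_step hβ hκ hF hL (run_valid g x₁ w N)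
      change F (run g x₁ w (N + 1)).x ≤ _ at h
      rw [add_div, mul_add]
      linarith
  have hv := run_valid g x₁ w n
  have hr := hv.root_pos
  have hr1 := hv.one_le_root
  have hq := hv.rad_pos
  have hq1 := hv.one_le_rad
  -- Both `rad` and `root` are nondecreasing, so their final values can be used in every
  -- denominator; as sumDir = rad² − 1, the accumulated progress is at least rad / root − 1.
  have h2 : (run g x₁ w n).sumDir / ((run g x₁ w n).rad * (run g x₁ w n).root) ≤
      ∑ i ∈ Finset.range (n + 1), ‖(run g x₁ w i).dir‖ ^ 2 /
        ((run g x₁ w i).rad * (run g x₁ w i).root) := by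
    rw [run_sumDir, Finset.sum_div]
    refine Finset.sum_le_sum fun i hi => ?_
    have hin : i ≤ n := by simpa [Nat.lt_succ_iff] using hi
    have hvi := run_valid g x₁ w i
    refine div_le_div_of_nonneg_left (sq_nonneg _) (mul_pos hvi.rad_pos hvi.root_pos) ?_
    exact mul_le_mul (run_rad_mono g x₁ w hin) (run_root_mono g x₁ w hin) hvi.root_pos.le hq.le
  have h3 : (run g x₁ w n).rad / (run g x₁ w n).root - 1 ≤
      (run g x₁ w n).sumDir / ((run g x₁ w n).rad * (run g x₁ w n).root) := by
    have : (run g x₁ w n).sumDir = (run g x₁ w n).rad ^ 2 - 1 := by rw [hv.rad_sq]; ring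
    rw [this, div_sub_one hr.ne', div_le_div_iff₀ hr (mul_pos hq hr)]
    have h5 : 1 ≤ (run g x₁ w n).rad * (run g x₁ w n).root := one_le_mul_of_one_le_of_one_le hq1 hr1
    nlinarith
  have h4 := mul_le_mul_of_nonneg_left (sum_dir_div_le_log g x₁ w n)
    (show 0 ≤ κ / 2 + β by positivity)
  linarith [h1 (n + 1), hmin (run g x₁ w (n + 1)).x]

end Path

end

section

/-! ### Variance inequalities in a Hilbert space. -/

section Moments

variable {α E : Type*} [MeasurableSpace α] {μ : Measure α} [IsProbabilityMeasure μ]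
  [NormedAddCommGroup E] [InnerProductSpace ℝ E] [CompleteSpace E]

theorem integral_norm_sub_integral_sq_le {h : α → E} (hi : Integrable h μ)
    (hi2 : Integrable (fun e => ‖h e‖ ^ 2) μ) :
    ∫ e, ‖h e - ∫ e', h e' ∂μ‖ ^ 2 ∂μ ≤ ∫ e, ‖h e‖ ^ 2 ∂μ := by
  set c := ∫ e', h e' ∂μ with hc
  have h1 : ∀ e, ‖h e - c‖ ^ 2 = ‖h e‖ ^ 2 - 2 * inner ℝ c (h e) + ‖c‖ ^ 2 := fun e => by
    rw [norm_sub_sq_real, real_inner_comm]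
  simp only [h1]
  have h2 : Integrable (fun e => 2 * inner ℝ c (h e)) μ := (hi.const_inner c).const_mul 2
  have h3 : Integrable (fun e => ‖h e‖ ^ 2 - 2 * inner ℝ c (h e)) μ := hi2.sub h2
  rw [integral_add h3 (integrable_const _), integral_sub hi2 h2, integral_const_mul,
    integral_inner hi, ← hc, real_inner_self_eq_norm_sq]
  simp only [integral_const, probReal_univ, smul_eq_mul, one_mul]
  nlinarith [sq_nonneg ‖c‖]

theorem norm_integral_le_of_sq_integral_le {h : α → E} {c : ℝ} (hc : 0 ≤ c)
    (hi : Integrable h μ) (hi2 : Integrable (fun e => ‖h e‖ ^ 2) μ)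
    (hle : ∫ e, ‖h e‖ ^ 2 ∂μ ≤ c ^ 2) : ‖∫ e, h e ∂μ‖ ≤ c := by
  set m := ∫ e, h e ∂μ with hm
  have h1 : ∀ e, ‖h e - m‖ ^ 2 = ‖h e‖ ^ 2 - 2 * inner ℝ m (h e) + ‖m‖ ^ 2 := fun e => by
    rw [norm_sub_sq_real, real_inner_comm]
  have h0 : 0 ≤ ∫ e, ‖h e - m‖ ^ 2 ∂μ := integral_nonneg fun e => sq_nonneg _
  simp only [h1] at h0
  have h2 : Integrable (fun e => 2 * inner ℝ m (h e)) μ := (hi.const_inner m).const_mul 2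
  have h3 : Integrable (fun e => ‖h e‖ ^ 2 - 2 * inner ℝ m (h e)) μ := hi2.sub h2
  rw [integral_add h3 (integrable_const _), integral_sub hi2 h2, integral_const_mul,
    integral_inner hi, ← hm, real_inner_self_eq_norm_sq] at h0
  simp only [integral_const, probReal_univ, smul_eq_mul, one_mul] at h0
  exact le_of_sq_le_sq (by linarith) hc

end Moments

/-! ### Consequences of the assumptions for one sample. -/

namespace Assumptions

variable {d : ℕ} {Ξ : Type*} [MeasurableSpace Ξ] {f : EuclideanSpace ℝ (Fin d) → Ξ → ℝ}
  {μ : Measure Ξ} [IsProbabilityMeasure μ] {σ β G : ℝ} (hA : Assumptions f μ σ β G)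
include hA

omit [IsProbabilityMeasure μ] in
theorem measurable_apply (x : EuclideanSpace ℝ (Fin d)) : Measurable (stochGrad f x) :=
  hA.measurable_stochGrad.comp (measurable_const.prodMk measurable_id)

theorem integrable_stochGrad (x : EuclideanSpace ℝ (Fin d)) : Integrable (stochGrad f x) μ :=
  Integrable.of_bound (hA.measurable_apply x).aestronglyMeasurable G
    (hA.bounded.mono fun _ h => h x)

theorem integrable_norm_sq (x : EuclideanSpace ℝ (Fin d)) :
    Integrable (fun e => ‖stochGrad f x e‖ ^ 2) μ :=
  Integrable.of_bound ((hA.measurable_apply x).norm.pow_const 2).aestronglyMeasurable (G ^ 2)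
    (hA.bounded.mono fun e h => by
      rw [Real.norm_of_nonneg (sq_nonneg _)]
      exact pow_le_pow_left₀ (norm_nonneg _) (h x) 2)

theorem integrable_norm_sub_sq (x y : EuclideanSpace ℝ (Fin d)) :
    Integrable (fun e => ‖stochGrad f x e - stochGrad f y e‖ ^ 2) μ :=
  Integrable.of_bound (((hA.measurable_apply x).sub (hA.measurable_apply y)).norm.pow_const
    2).aestronglyMeasurable ((G + G) ^ 2) (hA.bounded.mono fun e h => by
      rw [Real.norm_of_nonneg (sq_nonneg _)]
      exact pow_le_pow_left₀ (norm_nonneg _)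
        ((norm_sub_le _ _).trans (add_le_add (h x) (h y))) 2)

omit [IsProbabilityMeasure μ] in
theorem gradient_eq (x : EuclideanSpace ℝ (Fin d)) :
    gradient (objective f μ) x = ∫ e, stochGrad f x e ∂μ := (hA.unbiased x).gradient

omit [IsProbabilityMeasure μ] in
theorem hasGradientAt (x : EuclideanSpace ℝ (Fin d)) :
    HasGradientAt (objective f μ) (gradient (objective f μ) x) x :=
  hA.gradient_eq x ▸ hA.unbiased x

theorem norm_gradient_le (x : EuclideanSpace ℝ (Fin d)) :
    ‖gradient (objective f μ) x‖ ≤ G := by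
  rw [hA.gradient_eq]
  simpa using norm_integral_le_of_norm_le_const (hA.bounded.mono fun _ h => h x)

/-- By Jensen's inequality, mean-square smoothness of the oracle passes to its mean. -/
theorem lipschitz_gradient (hβ : 0 ≤ β) (x y : EuclideanSpace ℝ (Fin d)) :
    ‖gradient (objective f μ) x - gradient (objective f μ) y‖ ≤ β * ‖x - y‖ := by
  rw [hA.gradient_eq, hA.gradient_eq,
    ← integral_sub (hA.integrable_stochGrad x) (hA.integrable_stochGrad y)]
  refine norm_integral_le_of_sq_integral_le (by positivity)
    ((hA.integrable_stochGrad x).sub (hA.integrable_stochGrad y))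
    (hA.integrable_norm_sub_sq x y) ?_
  rw [mul_pow]
  exact hA.smooth x y

theorem measurable_gradient (hβ : 0 ≤ β) : Measurable (gradient (objective f μ)) := by
  have h : LipschitzWith β.toNNReal (gradient (objective f μ)) :=
    LipschitzWith.of_dist_le_mul fun x y => by
      rw [dist_eq_norm, dist_eq_norm, Real.coe_toNNReal _ hβ]
      exact hA.lipschitz_gradient hβ x y
  exact h.continuous.measurable

/-- The one-step recursion for the error of the gradient estimate. -/
theorem integral_error_step_le (x y v : EuclideanSpace ℝ (Fin d)) {a : ℝ} (ha0 : 0 ≤ a)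
    (ha1 : a ≤ 1) :
    ∫ e, ‖stochGrad f y e + (1 - a) • (v - stochGrad f x e) - gradient (objective f μ) y‖ ^ 2 ∂μ ≤
      (1 - a) * ‖v - gradient (objective f μ) x‖ ^ 2 +
        2 * a ^ 2 * ∫ e, ‖stochGrad f y e‖ ^ 2 ∂μ + 2 * (β ^ 2 * ‖y - x‖ ^ 2) := by
  set Fx := gradient (objective f μ) x with hFx
  set Fy := gradient (objective f μ) y with hFy
  -- The new error is (1 − a) times the old one plus a P + (1 − a) Q. Both P and Q are centred, so
  -- the cross term with the old error integrates to zero.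
  set P : Ξ → EuclideanSpace ℝ (Fin d) := fun e => stochGrad f y e - Fy with hP
  set Q : Ξ → EuclideanSpace ℝ (Fin d) :=
    fun e => (stochGrad f y e - stochGrad f x e) - (Fy - Fx) with hQ
  have iy := hA.integrable_stochGrad y
  have ix := hA.integrable_stochGrad x
  have iP : Integrable P μ := iy.sub (integrable_const _)
  have iQ : Integrable Q μ := (iy.sub ix).sub (integrable_const _)
  have mP : ∫ e, P e ∂μ = 0 := by
    rw [hP, integral_sub iy (integrable_const _), hFy, hA.gradient_eq]; simp
  have mQ : ∫ e, Q e ∂μ = 0 := by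
    have iyx : Integrable (fun e => stochGrad f y e - stochGrad f x e) μ := iy.sub ix
    rw [hQ, integral_sub iyx (integrable_const _), integral_sub iy ix, hFy, hFx,
      hA.gradient_eq, hA.gradient_eq]
    simp
  have bnd : ∀ᵐ e ∂μ, ‖P e‖ ≤ G + G ∧ ‖Q e‖ ≤ (G + G) + (G + G) := hA.bounded.mono fun e h =>
    ⟨(norm_sub_le _ _).trans (add_le_add (h y) (hA.norm_gradient_le y)),
      (norm_sub_le _ _).trans (add_le_add ((norm_sub_le _ _).trans (add_le_add (h y) (h x)))
        ((norm_sub_le _ _).trans (add_le_add (hA.norm_gradient_le y) (hA.norm_gradient_le x))))⟩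
  have iP2 : Integrable (fun e => ‖P e‖ ^ 2) μ :=
    Integrable.of_bound (iP.aestronglyMeasurable.norm.pow 2) ((G + G) ^ 2)
      (bnd.mono fun e h => by
        rw [Real.norm_of_nonneg (sq_nonneg _)]
        exact pow_le_pow_left₀ (norm_nonneg _) h.1 2)
  have iQ2 : Integrable (fun e => ‖Q e‖ ^ 2) μ :=
    Integrable.of_bound (iQ.aestronglyMeasurable.norm.pow 2) (((G + G) + (G + G)) ^ 2)
      (bnd.mono fun e h => by
        rw [Real.norm_of_nonneg (sq_nonneg _)]
        exact pow_le_pow_left₀ (norm_nonneg _) h.2 2)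
  -- The raw second moment is kept instead of σ², because the adaptive sum of ‖g‖² is what becomes a
  -- logarithm.
  have bP : ∫ e, ‖P e‖ ^ 2 ∂μ ≤ ∫ e, ‖stochGrad f y e‖ ^ 2 ∂μ := by
    rw [hP, hFy, hA.gradient_eq]
    exact integral_norm_sub_integral_sq_le iy (hA.integrable_norm_sq y)
  have bQ : ∫ e, ‖Q e‖ ^ 2 ∂μ ≤ β ^ 2 * ‖y - x‖ ^ 2 := by
    refine le_trans ?_ (hA.smooth y x)
    have := integral_norm_sub_integral_sq_le (iy.sub ix) (hA.integrable_norm_sub_sq y x)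
    simp only [Pi.sub_apply] at this
    rwa [integral_sub iy ix, ← hA.gradient_eq, ← hA.gradient_eq] at this
  have point : ∀ e, ‖stochGrad f y e + (1 - a) • (v - stochGrad f x e) - Fy‖ ^ 2 ≤
      (1 - a) * ‖v - Fx‖ ^ 2 + (2 * (1 - a)) * inner ℝ (v - Fx) (a • P e + (1 - a) • Q e) +
        2 * a ^ 2 * ‖P e‖ ^ 2 + 2 * ‖Q e‖ ^ 2 := by
    intro e
    have e1 : stochGrad f y e + (1 - a) • (v - stochGrad f x e) - Fy =
        (1 - a) • (v - Fx) + (a • P e + (1 - a) • Q e) := by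
      simp only [hP, hQ]; module
    have e2 : ‖a • P e + (1 - a) • Q e‖ ^ 2 ≤ 2 * a ^ 2 * ‖P e‖ ^ 2 + 2 * ‖Q e‖ ^ 2 := by
      have e3 : ‖a • P e + (1 - a) • Q e‖ ≤ a * ‖P e‖ + (1 - a) * ‖Q e‖ := by
        refine (norm_add_le _ _).trans (le_of_eq ?_)
        rw [norm_smul, norm_smul, Real.norm_of_nonneg ha0, Real.norm_of_nonneg (by linarith)]
      have e4 := pow_le_pow_left₀ (norm_nonneg _) e3 2
      have e5 : (1 - a) * ‖Q e‖ ≤ ‖Q e‖ := mul_le_of_le_one_left (norm_nonneg _) (by linarith)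
      have e6 : 0 ≤ (1 - a) * ‖Q e‖ := mul_nonneg (by linarith) (norm_nonneg _)
      nlinarith [sq_nonneg (a * ‖P e‖ - (1 - a) * ‖Q e‖)]
    rw [e1, norm_add_sq_real, norm_smul, mul_pow, Real.norm_of_nonneg (by linarith),
      inner_smul_left]
    have e7 : (1 - a) ^ 2 * ‖v - Fx‖ ^ 2 ≤ (1 - a) * ‖v - Fx‖ ^ 2 :=
      mul_le_mul_of_nonneg_right (by nlinarith) (sq_nonneg _)
    simp only [conj_trivial]
    linarith
  have iaP : Integrable (fun e => a • P e) μ := iP.smul a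
  have iaQ : Integrable (fun e => (1 - a) • Q e) μ := iQ.smul (1 - a)
  have iPQ : Integrable (fun e => a • P e + (1 - a) • Q e) μ := iaP.add iaQ
  have iI : Integrable (fun e => inner ℝ (v - Fx) (a • P e + (1 - a) • Q e)) μ :=
    iPQ.const_inner _
  have mI : ∫ e, inner ℝ (v - Fx) (a • P e + (1 - a) • Q e) ∂μ = 0 := by
    rw [integral_inner iPQ, integral_add iaP iaQ, integral_smul, integral_smul, mP, mQ]
    simp
  have i1 := iI.const_mul (2 * (1 - a))
  have i2 := iP2.const_mul (2 * a ^ 2)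
  have i3 := iQ2.const_mul 2
  have i0 : Integrable (fun _ : Ξ => (1 - a) * ‖v - Fx‖ ^ 2) μ := integrable_const _
  have i01 : Integrable (fun e => (1 - a) * ‖v - Fx‖ ^ 2 +
      2 * (1 - a) * inner ℝ (v - Fx) (a • P e + (1 - a) • Q e)) μ := i0.add i1
  have i012 : Integrable (fun e => (1 - a) * ‖v - Fx‖ ^ 2 +
      2 * (1 - a) * inner ℝ (v - Fx) (a • P e + (1 - a) • Q e) + 2 * a ^ 2 * ‖P e‖ ^ 2) μ :=
    i01.add i2
  refine (integral_mono_of_nonneg (ae_of_all _ fun e => sq_nonneg _)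
    (i012.add i3) (ae_of_all _ point)).trans ?_
  simp only [Pi.add_apply]
  rw [integral_add i012 i3, integral_add i01 i2, integral_add i0 i1,
    integral_const_mul (2 * (1 - a)), mI]
  simp only [integral_const_mul, integral_const, probReal_univ, smul_eq_mul, one_mul]
  have := mul_le_mul_of_nonneg_left bP (show 0 ≤ 2 * a ^ 2 by positivity)
  linarith

end Assumptions

/-! ### Measurability, filtration and independence. -/

section Measurability

variable {d : ℕ} {Ξ : Type*}

/-- A state as a tuple. -/
def State.toProd (s : State d) :
    EuclideanSpace ℝ (Fin d) × EuclideanSpace ℝ (Fin d) × ℝ × ℝ :=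
  (s.x, s.dir, s.sumGrad, s.sumDir)

instance : MeasurableSpace (State d) := MeasurableSpace.comap State.toProd inferInstance

theorem State.measurable_toProd : Measurable (State.toProd (d := d)) := comap_measurable _

@[fun_prop]
theorem State.measurable_x : Measurable (State.x (d := d)) := State.measurable_toProd.fst

@[fun_prop]
theorem State.measurable_dir : Measurable (State.dir (d := d)) := State.measurable_toProd.snd.fst

@[fun_prop]
theorem State.measurable_sumGrad : Measurable (State.sumGrad (d := d)) :=
  State.measurable_toProd.snd.snd.fst

@[fun_prop]
theorem State.measurable_sumDir : Measurable (State.sumDir (d := d)) :=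
  State.measurable_toProd.snd.snd.snd

theorem State.measurable_mk {α : Type*} [MeasurableSpace α]
    {x v : α → EuclideanSpace ℝ (Fin d)} {G D : α → ℝ}
    (hx : Measurable x) (hv : Measurable v) (hG : Measurable G) (hD : Measurable D) :
    Measurable fun z => State.mk (x z) (v z) (G z) (D z) := by
  refine measurable_comap_iff.2 ?_
  exact hx.prodMk (hv.prodMk (hG.prodMk hD))

@[fun_prop]
theorem State.measurable_root : Measurable (State.root (d := d)) := by
  unfold State.root; fun_prop

@[fun_prop]
theorem State.measurable_rad : Measurable (State.rad (d := d)) := by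
  unfold State.rad; fun_prop

@[fun_prop]
theorem State.measurable_a : Measurable fun s : State d => s.a 1 := by
  unfold State.a; fun_prop

@[fun_prop]
theorem State.measurable_b : Measurable fun s : State d => s.b 1 1 (1 / 2) (1 / 4) := by
  unfold State.b; fun_prop

@[fun_prop]
theorem State.measurable_nextX : Measurable fun s : State d => s.nextX 1 1 1 (1 / 2) (1 / 4) := by
  unfold State.nextX; fun_prop

variable [MeasurableSpace Ξ]
  {g : EuclideanSpace ℝ (Fin d) → Ξ → EuclideanSpace ℝ (Fin d)}

theorem State.measurable_step
    (hg : Measurable fun z : EuclideanSpace ℝ (Fin d) × Ξ => g z.1 z.2) :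
    Measurable fun z : State d × Ξ => z.1.step g z.2 := by
  have h1 : Measurable fun z : State d × Ξ => g (z.1.nextX 1 1 1 (1 / 2) (1 / 4)) z.2 :=
    hg.comp (by fun_prop : Measurable fun z : State d × Ξ =>
      (z.1.nextX 1 1 1 (1 / 2) (1 / 4), z.2))
  have h2 : Measurable fun z : State d × Ξ => g z.1.x z.2 :=
    hg.comp (by fun_prop : Measurable fun z : State d × Ξ => (z.1.x, z.2))
  have h3 : Measurable fun z : State d × Ξ => z.1.nextDir g 1 1 1 (1 / 2) (1 / 4) z.2 := by
    unfold State.nextDir; fun_prop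
  exact State.measurable_mk (by fun_prop) h3 (by fun_prop) (by fun_prop)

/-- The σ-algebra generated by the first `n + 1` samples. -/
@[reducible]
def past (Ξ : Type*) [MeasurableSpace Ξ] (n : ℕ) : MeasurableSpace (ℕ → Ξ) :=
  ⨆ i ∈ Set.Iic n, MeasurableSpace.comap (fun w : ℕ → Ξ => w i) inferInstance

theorem past_mono {m n : ℕ} (h : m ≤ n) : past Ξ m ≤ past Ξ n :=
  biSup_mono fun _ hi => le_trans (Set.mem_Iic.1 hi) h

theorem measurable_past_eval {i n : ℕ} (h : i ≤ n) :
    Measurable[past Ξ n] fun w : ℕ → Ξ => w i :=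
  (comap_measurable _).mono (le_biSup (fun i =>
    MeasurableSpace.comap (fun w : ℕ → Ξ => w i) inferInstance) (Set.mem_Iic.2 h)) le_rfl

theorem past_le (n : ℕ) : past Ξ n ≤ MeasurableSpace.pi :=
  iSup₂_le fun i _ => (measurable_pi_apply i).comap_le

theorem measurable_past_run
    (hg : Measurable fun z : EuclideanSpace ℝ (Fin d) × Ξ => g z.1 z.2)
    (x₁ : EuclideanSpace ℝ (Fin d)) (n : ℕ) :
    Measurable[past Ξ n] fun w => run g x₁ w n := by
  induction n with
  | zero =>
    have h1 : Measurable (g x₁) := hg.comp (measurable_const.prodMk measurable_id)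
    have h2 : Measurable fun e => State.mk x₁ (g x₁ e) (‖g x₁ e‖ ^ 2) (‖g x₁ e‖ ^ 2) :=
      State.measurable_mk measurable_const h1 (by fun_prop) (by fun_prop)
    exact h2.comp (measurable_past_eval le_rfl)
  | succ n ih =>
    exact (State.measurable_step hg).comp
      ((ih.mono (past_mono n.le_succ) le_rfl).prodMk (measurable_past_eval le_rfl))

theorem measurable_run
    (hg : Measurable fun z : EuclideanSpace ℝ (Fin d) × Ξ => g z.1 z.2)
    (x₁ : EuclideanSpace ℝ (Fin d)) (n : ℕ) : Measurable fun w => run g x₁ w n :=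
  (measurable_past_run hg x₁ n).mono (past_le n) le_rfl

/-- The law of the sequence of samples. -/
def sampleLaw (μ : Measure Ξ) [IsProbabilityMeasure μ] : Measure (ℕ → Ξ) :=
  Measure.infinitePi fun _ => μ

variable {μ : Measure Ξ} [IsProbabilityMeasure μ]

instance : IsProbabilityMeasure (sampleLaw μ) := by unfold sampleLaw; infer_instance

theorem sampleLaw_map_eval (n : ℕ) : (sampleLaw μ).map (fun w => w n) = μ :=
  Measure.infinitePi_map_eval _ n

/-- The state with index n depends only on the samples 0, …, n, a block disjoint from sample n + 1.
-/
theorem indepFun_run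
    (hg : Measurable fun z : EuclideanSpace ℝ (Fin d) × Ξ => g z.1 z.2)
    (x₁ : EuclideanSpace ℝ (Fin d)) (n : ℕ) :
    IndepFun (fun w => run g x₁ w n) (fun w => w (n + 1)) (sampleLaw μ) := by
  have h1 : iIndepFun (fun (i : ℕ) (w : ℕ → Ξ) => w i) (sampleLaw μ) :=
    iIndepFun_infinitePi (X := fun _ => id) fun _ => measurable_id
  have h2 := indep_iSup_of_disjoint (fun i => (measurable_pi_apply i).comap_le) h1
    (S := Set.Iic n) (T := {n + 1}) (by simp)
  rw [IndepFun_iff_Indep]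
  refine indep_of_indep_of_le_left (indep_of_indep_of_le_right h2 ?_)
    (measurable_past_run hg x₁ n).comap_le
  simp

/-- Fubini for the state of a round and the next sample. -/
theorem integral_run_next
    (hg : Measurable fun z : EuclideanSpace ℝ (Fin d) × Ξ => g z.1 z.2)
    (x₁ : EuclideanSpace ℝ (Fin d)) (n : ℕ) {φ : State d → Ξ → ℝ}
    (hφ : Measurable fun z : State d × Ξ => φ z.1 z.2)
    (hi : Integrable (fun w => φ (run g x₁ w n) (w (n + 1))) (sampleLaw μ)) :
    ∫ w, φ (run g x₁ w n) (w (n + 1)) ∂sampleLaw μ =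
      ∫ w, ∫ e, φ (run g x₁ w n) e ∂μ ∂sampleLaw μ := by
  have hr := measurable_run hg x₁ n
  have he : Measurable fun w : ℕ → Ξ => w (n + 1) := measurable_pi_apply _
  have h1 := (indepFun_iff_map_prod_eq_prod_map_map hr.aemeasurable he.aemeasurable).1
    (indepFun_run (μ := μ) hg x₁ n)
  rw [sampleLaw_map_eval] at h1
  have : IsProbabilityMeasure ((sampleLaw μ).map fun w => run g x₁ w n) :=
    Measure.isProbabilityMeasure_map hr.aemeasurable
  have h2 := integral_map (μ := sampleLaw μ) (hr.prodMk he).aemeasurable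
    (f := fun z : State d × Ξ => φ z.1 z.2) hφ.aestronglyMeasurable
  have h3 := (integrable_map_measure (μ := sampleLaw μ) (g := fun z : State d × Ξ => φ z.1 z.2)
    hφ.aestronglyMeasurable (hr.prodMk he).aemeasurable).2 hi
  rw [h1] at h2 h3
  rw [← h2, integral_prod _ h3, integral_map hr.aemeasurable]
  exact hφ.stronglyMeasurable.integral_prod_right.aestronglyMeasurable

theorem integral_run_next_nonpos
    (hg : Measurable fun z : EuclideanSpace ℝ (Fin d) × Ξ => g z.1 z.2)
    (x₁ : EuclideanSpace ℝ (Fin d)) (n : ℕ) {φ : State d → Ξ → ℝ}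
    (hφ : Measurable fun z : State d × Ξ => φ z.1 z.2)
    (hi : Integrable (fun w => φ (run g x₁ w n) (w (n + 1))) (sampleLaw μ))
    (hle : ∀ s : State d, s.Valid → ∫ e, φ s e ∂μ ≤ 0) :
    ∫ w, φ (run g x₁ w n) (w (n + 1)) ∂sampleLaw μ ≤ 0 := by
  rw [integral_run_next hg x₁ n hφ hi]
  exact integral_nonpos fun w => hle _ (run_valid g x₁ w n)

end Measurability

end

section

/-! ### Integrability through essential bounds. -/

section EssBdd

variable {Ω : Type*} [MeasurableSpace Ω] {P : Measure Ω} {u v : Ω → ℝ}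

/-- Measurable and essentially bounded. -/
def EssBdd (P : Measure Ω) (u : Ω → ℝ) : Prop :=
  AEStronglyMeasurable u P ∧ ∃ C, ∀ᵐ ω ∂P, |u ω| ≤ C

theorem EssBdd.of_le (hu : Measurable u) (hv : EssBdd P v) (h : ∀ᵐ ω ∂P, |u ω| ≤ v ω) :
    EssBdd P u := by
  obtain ⟨-, C, hC⟩ := hv
  exact ⟨hu.aestronglyMeasurable, C, by
    filter_upwards [h, hC] with ω h1 h2 using h1.trans ((le_abs_self _).trans h2)⟩

theorem EssBdd.const (c : ℝ) : EssBdd P fun _ => c :=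
  ⟨aestronglyMeasurable_const, |c|, ae_of_all _ fun _ => le_rfl⟩

theorem EssBdd.add (hu : EssBdd P u) (hv : EssBdd P v) : EssBdd P fun ω => u ω + v ω := by
  obtain ⟨mu, C, hC⟩ := hu
  obtain ⟨mv, C', hC'⟩ := hv
  exact ⟨mu.add mv, C + C', by
    filter_upwards [hC, hC'] with ω h1 h2 using (abs_add_le _ _).trans (add_le_add h1 h2)⟩

theorem EssBdd.sub (hu : EssBdd P u) (hv : EssBdd P v) : EssBdd P fun ω => u ω - v ω := by
  obtain ⟨mu, C, hC⟩ := hu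
  obtain ⟨mv, C', hC'⟩ := hv
  exact ⟨mu.sub mv, C + C', by
    filter_upwards [hC, hC'] with ω h1 h2 using (abs_sub _ _).trans (add_le_add h1 h2)⟩

theorem EssBdd.mul (hu : EssBdd P u) (hv : EssBdd P v) : EssBdd P fun ω => u ω * v ω := by
  obtain ⟨mu, C, hC⟩ := hu
  obtain ⟨mv, C', hC'⟩ := hv
  exact ⟨mu.mul mv, C * C', by
    filter_upwards [hC, hC'] with ω h1 h2
    rw [abs_mul]
    exact mul_le_mul h1 h2 (abs_nonneg _) ((abs_nonneg _).trans h1)⟩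

theorem EssBdd.const_mul (hu : EssBdd P u) (c : ℝ) : EssBdd P fun ω => c * u ω :=
  (EssBdd.const c).mul hu

theorem EssBdd.sq (hu : EssBdd P u) : EssBdd P fun ω => u ω ^ 2 := by
  simpa only [pow_two] using hu.mul hu

theorem EssBdd.sum {ι : Type*} (s : Finset ι) {u : ι → Ω → ℝ} (hu : ∀ i ∈ s, EssBdd P (u i)) :
    EssBdd P fun ω => ∑ i ∈ s, u i ω := by
  classical
  induction s using Finset.induction_on with
  | empty => simpa using EssBdd.const 0
  | insert i s hi ih =>
    simp only [Finset.sum_insert hi]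
    exact (hu i (Finset.mem_insert_self _ _)).add
      (ih fun j hj => hu j (Finset.mem_insert_of_mem hj))

theorem EssBdd.integrable [IsFiniteMeasure P] (hu : EssBdd P u) : Integrable u P := by
  obtain ⟨mu, C, hC⟩ := hu
  exact Integrable.of_bound mu C hC

end EssBdd

variable {d : ℕ} {Ξ : Type*}

section Bounds

variable {g : EuclideanSpace ℝ (Fin d) → Ξ → EuclideanSpace ℝ (Fin d)}
  {x₁ : EuclideanSpace ℝ (Fin d)} {w : ℕ → Ξ} {G : ℝ}

theorem State.Valid.a_nonneg {s : State d} (hs : s.Valid) : 0 ≤ s.a 1 := by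
  rw [hs.a_eq]; have := hs.root_pos; positivity

theorem State.Valid.a_le_one {s : State d} (hs : s.Valid) : s.a 1 ≤ 1 := by
  rw [hs.a_eq]; exact inv_le_one_of_one_le₀ (one_le_pow₀ hs.one_le_root)

/-- A crude bound growing with n, used for integrability only. -/
theorem norm_dir_le (hw : ∀ n x, ‖g x (w n)‖ ≤ G) (n : ℕ) :
    ‖(run g x₁ w n).dir‖ ≤ (2 * n + 1) * G := by
  induction n with
  | zero => simpa [run, metaStormSG] using hw 0 x₁
  | succ n ih =>
    have hs := run_valid g x₁ w n
    have h1 : (run g x₁ w (n + 1)).dir = g (run g x₁ w (n + 1)).x (w (n + 1)) +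
      (1 - (run g x₁ w n).a 1) • ((run g x₁ w n).dir - g (run g x₁ w n).x (w (n + 1))) := rfl
    have h2 : ‖(1 - (run g x₁ w n).a 1) •
        ((run g x₁ w n).dir - g (run g x₁ w n).x (w (n + 1)))‖ ≤ (2 * n + 1) * G + G := by
      rw [norm_smul, Real.norm_of_nonneg (by linarith [hs.a_le_one])]
      refine (mul_le_of_le_one_left (norm_nonneg _) (by linarith [hs.a_nonneg])).trans ?_
      exact (norm_sub_le _ _).trans (add_le_add ih (hw _ _))
    rw [h1]
    refine (norm_add_le _ _).trans ((add_le_add (hw _ _) h2).trans (le_of_eq ?_))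
    push_cast
    ring

theorem State.Valid.root_le {s : State d} (hs : s.Valid) : s.root ≤ 1 + s.sumGrad := by
  rw [← hs.root_pow_six]
  exact le_self_pow₀ hs.one_le_root (by norm_num)

theorem State.Valid.rad_le {s : State d} (hs : s.Valid) : s.rad ≤ 1 + s.sumDir := by
  rw [← hs.rad_sq]
  exact le_self_pow₀ hs.one_le_rad (by norm_num)

end Bounds

/-! ### The weight of the squared error. -/

section Weight

/-- The weight of the squared error, a shifted version of `1 / √a`. -/
def State.weight (s : State d) (k : ℝ) : ℝ := (k ^ 3 + s.sumGrad) ^ (1 / 3 : ℝ)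

@[fun_prop]
theorem State.measurable_weight (k : ℝ) : Measurable fun s : State d => s.weight k := by
  unfold State.weight; fun_prop

variable {s : State d} {k : ℝ}

theorem State.Valid.weight_pow_three (hs : s.Valid) (hk : 1 ≤ k) :
    s.weight k ^ 3 = k ^ 3 + s.sumGrad := by
  have := hs.1
  rw [weight, ← Real.rpow_natCast, ← Real.rpow_mul (by positivity)]
  norm_num

theorem State.Valid.le_weight (hs : s.Valid) (hk : 1 ≤ k) : k ≤ s.weight k := by
  refine le_of_pow_le_pow_left₀ (n := 3) (by norm_num) ?_ ?_
  · exact Real.rpow_nonneg (by have := hs.1; positivity) _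
  · rw [hs.weight_pow_three hk]; linarith [hs.1]

theorem State.Valid.root_sq_le_weight (hs : s.Valid) (hk : 1 ≤ k) : s.root ^ 2 ≤ s.weight k := by
  refine le_of_pow_le_pow_left₀ (n := 3) (by norm_num) ?_ ?_
  · linarith [hs.le_weight hk]
  · rw [hs.weight_pow_three hk, ← pow_mul, hs.root_pow_six]
    linarith [one_le_pow₀ hk (n := 3)]

theorem State.Valid.weight_le (hs : s.Valid) (hk : 1 ≤ k) : s.weight k ≤ k * s.root ^ 2 := by
  refine le_of_pow_le_pow_left₀ (n := 3) (by norm_num) (by positivity) ?_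
  rw [hs.weight_pow_three hk, mul_pow, ← pow_mul, hs.root_pow_six]
  nlinarith [one_le_pow₀ hk (n := 3), hs.1]

/-- With a = root⁻⁴ and a weight of at least root², the contraction removes at least root⁻² times
the squared error, the amount counted in `sumErr`. -/
theorem inv_root_sq_le (hs : s.Valid) (hk : 1 ≤ k) :
    (s.root ^ 2)⁻¹ ≤ s.weight k * s.a 1 := by
  have hr := hs.root_pos
  rw [hs.a_eq, ← div_eq_mul_inv, le_div_iff₀ (by positivity)]
  refine le_trans (le_of_eq ?_) (hs.root_sq_le_weight hk)
  field_simp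

theorem inv_weight_le (hs : s.Valid) (hk : 1 ≤ k) :
    (s.weight k)⁻¹ ≤ s.weight k * s.a 1 :=
  (inv_anti₀ (by have := hs.root_pos; positivity) (hs.root_sq_le_weight hk)).trans
    (inv_root_sq_le hs hk)

/-- The exponents match: root² · root⁻⁸ = root⁻⁶ is the reciprocal of 1 + sumGrad, so the variance
terms have a logarithmic sum. -/
theorem weight_mul_a_sq_le (hs : s.Valid) (hk : 1 ≤ k) :
    s.weight k * s.a 1 ^ 2 ≤ k / (1 + s.sumGrad) := by
  have hr := hs.root_pos
  rw [hs.a_eq, ← hs.root_pow_six, inv_pow, ← div_eq_mul_inv,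
    div_le_div_iff₀ (by positivity) (by positivity)]
  have := mul_le_mul_of_nonneg_right (hs.weight_le hk) (show 0 ≤ s.root ^ 6 by positivity)
  refine this.trans (le_of_eq (by ring))

theorem weight_div_le (hs : s.Valid) (hk : 1 ≤ k) :
    s.weight k / (s.rad * s.root) ^ 2 ≤ k / (1 + s.sumDir) := by
  have hr := hs.root_pos
  have hq := hs.rad_pos
  rw [← hs.rad_sq, div_le_div_iff₀ (by positivity) (by positivity)]
  have := mul_le_mul_of_nonneg_right (hs.weight_le hk) (show 0 ≤ s.rad ^ 2 by positivity)
  refine this.trans (le_of_eq (by ring))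

/-- The weight grows slowly enough to be absorbed by the contraction of the error. -/
theorem weight_sub_weight_le {s' : State d} (hs : s.Valid) (hs' : s'.Valid) (hk : 1 ≤ k) {c : ℝ}
    (hc : c ≤ k) (h : s'.sumGrad = s.sumGrad + c) :
    s'.weight k - s.weight k ≤ s'.weight k * s'.a 1 / 2 := by
  have h1 := inv_weight_le hs' hk
  have hu := hs'.le_weight hk
  have hv := hs.le_weight hk
  have hu3 := hs'.weight_pow_three hk
  have hv3 := hs.weight_pow_three hk
  set u := s'.weight k
  set v := s.weight k
  have hup : 0 < u := by linarith
  have hvp : 0 < v := by linarith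
  -- The shift by k³ in the weight guarantees v ≥ k ≥ c; then 2cu ≤ 2uv ≤ u² + uv + v², which gives
  -- u − v ≤ 1 / (2u).
  have h2 : (u - v) * (u ^ 2 + u * v + v ^ 2) = c := by linear_combination hu3 - hv3 + h
  have h3 : u - v ≤ u⁻¹ / 2 := by
    rw [inv_eq_one_div, div_div, le_div_iff₀ (by positivity)]
    have h4 : 0 < u ^ 2 + u * v + v ^ 2 := by positivity
    have h5 : u - v = c / (u ^ 2 + u * v + v ^ 2) := by rw [eq_div_iff h4.ne', h2]
    rw [h5, div_mul_eq_mul_div, div_le_one h4]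
    nlinarith [sq_nonneg (u - v), mul_le_mul_of_nonneg_right (hc.trans hv) hup.le]
  linarith

end Weight

/-! ### The weighted error recursion in expectation. -/

section Expectation

variable [MeasurableSpace Ξ] {f : EuclideanSpace ℝ (Fin d) → Ξ → ℝ}
  {μ : Measure Ξ} [IsProbabilityMeasure μ] {σ β G : ℝ}

/-- The error of the gradient estimate in a state. -/
def State.err (s : State d) (f : EuclideanSpace ℝ (Fin d) → Ξ → ℝ) (μ : Measure Ξ) : ℝ :=
  ‖s.dir - gradient (objective f μ) s.x‖

namespace Assumptions

variable (hA : Assumptions f μ σ β G)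
include hA

theorem ae_bounded : ∀ᵐ w ∂sampleLaw μ, ∀ n x, ‖stochGrad f x (w n)‖ ≤ G := by
  refine ae_all_iff.2 fun n => ?_
  have h := hA.bounded
  rw [← sampleLaw_map_eval (μ := μ) n] at h
  exact ae_of_ae_map (measurable_pi_apply n).aemeasurable h

omit [IsProbabilityMeasure μ] in
theorem measurable_run (x₁ : EuclideanSpace ℝ (Fin d)) (n : ℕ) :
    Measurable fun w => run (stochGrad f) x₁ w n :=
  MetaStorm.measurable_run hA.measurable_stochGrad x₁ n

omit [IsProbabilityMeasure μ] in
theorem measurable_grad_comp {α : Type*} [MeasurableSpace α] {x : α → EuclideanSpace ℝ (Fin d)}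
    {e : α → Ξ} (hx : Measurable x) (he : Measurable e) :
    Measurable fun z => stochGrad f (x z) (e z) :=
  hA.measurable_stochGrad.comp (hx.prodMk he)

theorem essBdd_norm_dir (x₁ : EuclideanSpace ℝ (Fin d)) (n : ℕ) :
    EssBdd (sampleLaw μ) fun w => ‖(run (stochGrad f) x₁ w n).dir‖ := by
  have := hA.measurable_run x₁ n
  refine EssBdd.of_le (by fun_prop) (EssBdd.const ((2 * n + 1) * G))
    (hA.ae_bounded.mono fun w hw => ?_)
  rw [abs_norm]
  exact norm_dir_le hw n

theorem essBdd_norm_grad {x : (ℕ → Ξ) → EuclideanSpace ℝ (Fin d)} (hx : Measurable x) (n : ℕ) :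
    EssBdd (sampleLaw μ) fun w => ‖stochGrad f (x w) (w n)‖ :=
  EssBdd.of_le (hA.measurable_grad_comp hx (measurable_pi_apply n)).norm (EssBdd.const G)
    (hA.ae_bounded.mono fun w hw => by rw [abs_norm]; exact hw _ _)

theorem essBdd_norm_gradient (hβ : 0 ≤ β) {x : (ℕ → Ξ) → EuclideanSpace ℝ (Fin d)}
    (hx : Measurable x) :
    EssBdd (sampleLaw μ) fun w => ‖gradient (objective f μ) (x w)‖ :=
  EssBdd.of_le ((hA.measurable_gradient hβ).comp hx).norm (EssBdd.const G)
    (ae_of_all _ fun w => by rw [abs_norm]; exact hA.norm_gradient_le _)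

theorem essBdd_sumGrad (x₁ : EuclideanSpace ℝ (Fin d)) (n : ℕ) :
    EssBdd (sampleLaw μ) fun w => (run (stochGrad f) x₁ w n).sumGrad := by
  simp only [run_sumGrad]
  exact EssBdd.sum _ fun i _ =>
    (hA.essBdd_norm_grad (State.measurable_x.comp (hA.measurable_run x₁ i)) i).sq

theorem essBdd_sumDir (x₁ : EuclideanSpace ℝ (Fin d)) (n : ℕ) :
    EssBdd (sampleLaw μ) fun w => (run (stochGrad f) x₁ w n).sumDir := by
  simp only [run_sumDir]
  exact EssBdd.sum _ fun i _ => (hA.essBdd_norm_dir x₁ i).sq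

theorem essBdd_log_sumGrad (x₁ : EuclideanSpace ℝ (Fin d)) (n : ℕ) :
    EssBdd (sampleLaw μ) fun w => Real.log (1 + (run (stochGrad f) x₁ w n).sumGrad) := by
  have := hA.measurable_run x₁ n
  refine EssBdd.of_le (by fun_prop) (hA.essBdd_sumGrad x₁ n) (ae_of_all _ fun w => ?_)
  have h := (run_valid (stochGrad f) x₁ w n).1
  rw [abs_of_nonneg (Real.log_nonneg (by linarith))]
  linarith [Real.log_le_sub_one_of_pos (show 0 < 1 + (run (stochGrad f) x₁ w n).sumGrad by
    linarith)]

theorem essBdd_log_sumDir (x₁ : EuclideanSpace ℝ (Fin d)) (n : ℕ) :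
    EssBdd (sampleLaw μ) fun w => Real.log (1 + (run (stochGrad f) x₁ w n).sumDir) := by
  have := hA.measurable_run x₁ n
  refine EssBdd.of_le (by fun_prop) (hA.essBdd_sumDir x₁ n) (ae_of_all _ fun w => ?_)
  have h := (run_valid (stochGrad f) x₁ w n).2
  rw [abs_of_nonneg (Real.log_nonneg (by linarith))]
  linarith [Real.log_le_sub_one_of_pos (show 0 < 1 + (run (stochGrad f) x₁ w n).sumDir by
    linarith)]

theorem essBdd_root (x₁ : EuclideanSpace ℝ (Fin d)) (n : ℕ) :
    EssBdd (sampleLaw μ) fun w => (run (stochGrad f) x₁ w n).root := by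
  have := hA.measurable_run x₁ n
  refine EssBdd.of_le (by fun_prop) ((EssBdd.const 1).add (hA.essBdd_sumGrad x₁ n))
    (ae_of_all _ fun w => ?_)
  have h := run_valid (stochGrad f) x₁ w n
  rw [abs_of_pos h.root_pos]
  exact h.root_le

theorem essBdd_rad (x₁ : EuclideanSpace ℝ (Fin d)) (n : ℕ) :
    EssBdd (sampleLaw μ) fun w => (run (stochGrad f) x₁ w n).rad := by
  have := hA.measurable_run x₁ n
  refine EssBdd.of_le (by fun_prop) ((EssBdd.const 1).add (hA.essBdd_sumDir x₁ n))
    (ae_of_all _ fun w => ?_)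
  have h := run_valid (stochGrad f) x₁ w n
  rw [abs_of_pos h.rad_pos]
  exact h.rad_le

theorem measurable_err (hβ : 0 ≤ β) :
    Measurable fun s : State d => s.err f μ := by
  have := hA.measurable_gradient hβ
  unfold State.err
  fun_prop

theorem essBdd_err (hβ : 0 ≤ β) (x₁ : EuclideanSpace ℝ (Fin d)) (n : ℕ) :
    EssBdd (sampleLaw μ) fun w => (run (stochGrad f) x₁ w n).err f μ := by
  refine EssBdd.of_le ((hA.measurable_err hβ).comp (hA.measurable_run x₁ n))
    ((hA.essBdd_norm_dir x₁ n).add (EssBdd.const G)) (ae_of_all _ fun w => ?_)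
  rw [State.err, abs_norm]
  exact (norm_sub_le _ _).trans (add_le_add le_rfl (hA.norm_gradient_le _))

theorem essBdd_err_div (hβ : 0 ≤ β) (x₁ : EuclideanSpace ℝ (Fin d)) (n : ℕ) :
    EssBdd (sampleLaw μ) fun w => (run (stochGrad f) x₁ w n).err f μ ^ 2 /
      (run (stochGrad f) x₁ w n).root ^ 2 := by
  have h1 := hA.measurable_run x₁ n
  have h2 := (hA.measurable_err hβ).comp h1
  refine EssBdd.of_le (Measurable.div (h2.pow_const 2) (by fun_prop))
    (hA.essBdd_err hβ x₁ n).sq (ae_of_all _ fun w => ?_)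
  have h := run_valid (stochGrad f) x₁ w n
  rw [abs_of_nonneg (by positivity)]
  exact div_le_self (sq_nonneg _) (one_le_pow₀ h.one_le_root)

theorem essBdd_weight {k : ℝ} (hk : 1 ≤ k) (x₁ : EuclideanSpace ℝ (Fin d)) (n : ℕ) :
    EssBdd (sampleLaw μ) fun w => (run (stochGrad f) x₁ w n).weight k := by
  have := hA.measurable_run x₁ n
  refine EssBdd.of_le (by fun_prop) ((hA.essBdd_root x₁ n).sq.const_mul k)
    (ae_of_all _ fun w => ?_)
  have h := run_valid (stochGrad f) x₁ w n
  rw [abs_of_nonneg (by linarith [h.le_weight hk])]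
  exact h.weight_le hk

theorem essBdd_a (x₁ : EuclideanSpace ℝ (Fin d)) (n : ℕ) :
    EssBdd (sampleLaw μ) fun w => (run (stochGrad f) x₁ w n).a 1 := by
  have := hA.measurable_run x₁ n
  refine EssBdd.of_le (by fun_prop) (EssBdd.const 1) (ae_of_all _ fun w => ?_)
  have h := run_valid (stochGrad f) x₁ w n
  rw [abs_of_nonneg h.a_nonneg]
  exact h.a_le_one

end Assumptions

/-- The excess of the weighted squared error of the next state over its conditional bound. -/
def excess (f : EuclideanSpace ℝ (Fin d) → Ξ → ℝ) (μ : Measure Ξ) (β k : ℝ) (s : State d)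
    (e : Ξ) : ℝ :=
  s.weight k * ((s.step (stochGrad f) e).err f μ ^ 2 - (1 - s.a 1) * s.err f μ ^ 2 -
    2 * s.a 1 ^ 2 * ‖stochGrad f (s.nextX 1 1 1 (1 / 2) (1 / 4)) e‖ ^ 2 -
    2 * β ^ 2 * (((s.rad * s.root)⁻¹) ^ 2 * ‖s.dir‖ ^ 2))

namespace Assumptions

variable (hA : Assumptions f μ σ β G)
include hA

/-- The weight is read off the current state, hence is constant with respect to the next sample;
what remains is the one-step error recursion. -/
theorem integral_excess_nonpos {k : ℝ} (hk : 1 ≤ k) {s : State d} (hs : s.Valid) :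
    ∫ e, excess f μ β k s e ∂μ ≤ 0 := by
  set y := s.nextX 1 1 1 (1 / 2) (1 / 4) with hy
  have hyx : ‖y - s.x‖ ^ 2 = ((s.rad * s.root)⁻¹) ^ 2 * ‖s.dir‖ ^ 2 := by
    rw [hy, hs.nextX_eq, sub_sub_cancel_left, norm_neg, norm_smul, mul_pow, Real.norm_eq_abs,
      sq_abs]
  have h1 := hA.integral_error_step_le s.x y s.dir hs.a_nonneg hs.a_le_one
  have e0 : ∀ e, (s.step (stochGrad f) e).err f μ = ‖stochGrad f y e +
      (1 - s.a 1) • (s.dir - stochGrad f s.x e) - gradient (objective f μ) y‖ := fun _ => rfl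
  have i1 : Integrable (fun e => (s.step (stochGrad f) e).err f μ ^ 2) μ := by
    simp only [e0]
    have hmy := hA.measurable_apply y
    have hmx := hA.measurable_apply s.x
    have m1 : Measurable fun e => stochGrad f y e + (1 - s.a 1) • (s.dir - stochGrad f s.x e) -
        gradient (objective f μ) y := by fun_prop
    refine Integrable.of_bound (m1.norm.pow_const 2).aestronglyMeasurable
      ((G + (‖s.dir‖ + G) + G) ^ 2) (hA.bounded.mono fun e he => ?_)
    rw [Real.norm_of_nonneg (sq_nonneg _)]
    refine pow_le_pow_left₀ (norm_nonneg _) ?_ 2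
    refine (norm_sub_le _ _).trans (add_le_add ((norm_add_le _ _).trans (add_le_add (he _) ?_))
      (hA.norm_gradient_le _))
    rw [norm_smul, Real.norm_of_nonneg (by linarith [hs.a_le_one])]
    refine (mul_le_of_le_one_left (norm_nonneg _) (by linarith [hs.a_nonneg])).trans ?_
    exact (norm_sub_le _ _).trans (add_le_add le_rfl (he _))
  have i2 : Integrable (fun e => 2 * s.a 1 ^ 2 * ‖stochGrad f y e‖ ^ 2) μ :=
    (hA.integrable_norm_sq y).const_mul _
  have i3 : Integrable (fun e => (s.step (stochGrad f) e).err f μ ^ 2 -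
      (1 - s.a 1) * s.err f μ ^ 2) μ := i1.sub (integrable_const _)
  have i4 : Integrable (fun e => (s.step (stochGrad f) e).err f μ ^ 2 -
      (1 - s.a 1) * s.err f μ ^ 2 - 2 * s.a 1 ^ 2 * ‖stochGrad f y e‖ ^ 2) μ := i3.sub i2
  unfold excess
  rw [integral_const_mul, integral_sub i4 (integrable_const _), integral_sub i3 i2,
    integral_sub i1 (integrable_const _), integral_const_mul (2 * s.a 1 ^ 2)]
  simp only [integral_const, probReal_univ, smul_eq_mul, one_mul]
  refine mul_nonpos_of_nonneg_of_nonpos (by linarith [hs.le_weight hk]) ?_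
  rw [hyx] at h1
  change ∫ e, (s.step (stochGrad f) e).err f μ ^ 2 ∂μ ≤ _ at h1
  change _ ≤ (1 - s.a 1) * s.err f μ ^ 2 + _ + _ at h1
  linarith

theorem essBdd_excess (hβ : 0 ≤ β) {k : ℝ} (hk : 1 ≤ k) (x₁ : EuclideanSpace ℝ (Fin d)) (n : ℕ) :
    EssBdd (sampleLaw μ) fun w => excess f μ β k (run (stochGrad f) x₁ w n) (w (n + 1)) := by
  have hm := hA.measurable_run x₁ n
  have h1 := (hA.essBdd_err hβ x₁ (n + 1)).sq
  have h2 := ((EssBdd.const 1).sub (hA.essBdd_a x₁ n)).mul (hA.essBdd_err hβ x₁ n).sq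
  have h3 := (hA.essBdd_norm_grad (State.measurable_x.comp (hA.measurable_run x₁ (n + 1)))
    (n + 1)).sq
  have h4 : EssBdd (sampleLaw μ) fun w =>
      ((run (stochGrad f) x₁ w n).rad * (run (stochGrad f) x₁ w n).root)⁻¹ := by
    refine EssBdd.of_le (by fun_prop) (EssBdd.const 1) (ae_of_all _ fun w => ?_)
    have h := run_valid (stochGrad f) x₁ w n
    rw [abs_of_pos (inv_pos.2 (mul_pos h.rad_pos h.root_pos))]
    exact inv_le_one_of_one_le₀ (one_le_mul_of_one_le_of_one_le h.one_le_rad h.one_le_root)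
  exact (hA.essBdd_weight hk x₁ n).mul (((h1.sub h2).sub
    (((hA.essBdd_a x₁ n).sq.const_mul 2).mul h3)).sub
    ((h4.sq.mul (hA.essBdd_norm_dir x₁ n).sq).const_mul (2 * β ^ 2)))

theorem measurable_excess (hβ : 0 ≤ β) (k : ℝ) :
    Measurable fun z : State d × Ξ => excess f μ β k z.1 z.2 := by
  have h1 := (hA.measurable_err hβ).comp (State.measurable_step hA.measurable_stochGrad)
  have h2 : Measurable fun z : State d × Ξ => z.1.err f μ :=
    (hA.measurable_err hβ).comp measurable_fst
  have h3 : Measurable fun z : State d × Ξ =>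
      stochGrad f (z.1.nextX 1 1 1 (1 / 2) (1 / 4)) z.2 :=
    hA.measurable_grad_comp (by fun_prop) measurable_snd
  unfold excess
  simp only [Function.comp_def] at h1
  fun_prop

theorem integral_excess_run_nonpos (hβ : 0 ≤ β) {k : ℝ} (hk : 1 ≤ k)
    (x₁ : EuclideanSpace ℝ (Fin d)) (n : ℕ) :
    ∫ w, excess f μ β k (run (stochGrad f) x₁ w n) (w (n + 1)) ∂sampleLaw μ ≤ 0 :=
  integral_run_next_nonpos hA.measurable_stochGrad x₁ n (hA.measurable_excess hβ k)
    (hA.essBdd_excess hβ hk x₁ n).integrable fun _ hs => hA.integral_excess_nonpos hk hs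

omit hA [IsProbabilityMeasure μ] in
-- The new weight depends on the new sample and cannot leave the conditional expectation. Half of
-- the contraction, the factor 1 − a/2, pays for replacing it by the old weight; the other half
-- produces the decrease by err² / root² / 2.
theorem _root_.MetaStorm.weighted_step (x₁ : EuclideanSpace ℝ (Fin d)) {w : ℕ → Ξ}
    (hw : ∀ n x, ‖stochGrad f x (w n)‖ ≤ G) (n : ℕ) :
    letI s := run (stochGrad f) x₁ w
    letI k := 1 + G ^ 2
    (s (n + 1)).weight k * (1 - (s (n + 1)).a 1 / 2) * (s (n + 1)).err f μ ^ 2 ≤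
      (s n).weight k * (1 - (s n).a 1 / 2) * (s n).err f μ ^ 2 -
        (s n).err f μ ^ 2 / (s n).root ^ 2 / 2 +
      2 * k * (‖stochGrad f (s (n + 1)).x (w (n + 1))‖ ^ 2 / (1 + (s n).sumGrad)) +
      2 * β ^ 2 * k * (‖(s n).dir‖ ^ 2 / (1 + (s n).sumDir)) +
      excess f μ β k (s n) (w (n + 1)) := by
  let s := run (stochGrad f) x₁ w
  let k := 1 + G ^ 2
  have hk : 1 ≤ k := le_add_of_nonneg_right (sq_nonneg G)
  have hs := run_valid (stochGrad f) x₁ w n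
  have hs' := run_valid (stochGrad f) x₁ w (n + 1)
  have hG : ‖stochGrad f (s (n + 1)).x (w (n + 1))‖ ^ 2 ≤ G ^ 2 :=
    pow_le_pow_left₀ (norm_nonneg _) (hw _ _) 2
  have h1 := weight_sub_weight_le hs hs' hk
    (hG.trans (by simp [k])) (run_succ_sumGrad (stochGrad f) x₁ w n)
  have h2 := mul_le_mul_of_nonneg_right h1 (sq_nonneg ((s (n + 1)).err f μ))
  have h3 := mul_le_mul_of_nonneg_right (inv_root_sq_le hs hk) (sq_nonneg ((s n).err f μ))
  have h4 := mul_le_mul_of_nonneg_right (weight_mul_a_sq_le hs hk)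
    (sq_nonneg ‖stochGrad f (s (n + 1)).x (w (n + 1))‖)
  have h5 := mul_le_mul_of_nonneg_right (weight_div_le hs hk) (sq_nonneg ‖(s n).dir‖)
  have h6 := mul_le_mul_of_nonneg_left h5 (sq_nonneg β)
  have h7 : excess f μ β k (s n) (w (n + 1)) = (s n).weight k * (s (n + 1)).err f μ ^ 2 -
      (s n).weight k * (1 - (s n).a 1) * (s n).err f μ ^ 2 -
      2 * ((s n).weight k * (s n).a 1 ^ 2 * ‖stochGrad f (s (n + 1)).x (w (n + 1))‖ ^ 2) -
      2 * (β ^ 2 * ((s n).weight k / ((s n).rad * (s n).root) ^ 2 * ‖(s n).dir‖ ^ 2)) := by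
    change (s n).weight k * ((s (n + 1)).err f μ ^ 2 - (1 - (s n).a 1) * (s n).err f μ ^ 2 -
      2 * (s n).a 1 ^ 2 * ‖stochGrad f (s (n + 1)).x (w (n + 1))‖ ^ 2 -
      2 * β ^ 2 * ((((s n).rad * (s n).root)⁻¹) ^ 2 * ‖(s n).dir‖ ^ 2)) = _
    rw [inv_pow]
    ring
  rw [h7]
  have e1 : (s n).err f μ ^ 2 / (s n).root ^ 2 / 2 =
    ((s n).root ^ 2)⁻¹ * (s n).err f μ ^ 2 / 2 := by ring
  have e2 : k / (1 + (s n).sumGrad) * ‖stochGrad f (s (n + 1)).x (w (n + 1))‖ ^ 2 =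
    k * (‖stochGrad f (s (n + 1)).x (w (n + 1))‖ ^ 2 / (1 + (s n).sumGrad)) := by ring
  have e3 : β ^ 2 * (k / (1 + (s n).sumDir) * ‖(s n).dir‖ ^ 2) =
    β ^ 2 * k * (‖(s n).dir‖ ^ 2 / (1 + (s n).sumDir)) := by ring
  rw [e1]
  rw [e2] at h4
  rw [e3] at h6
  dsimp only [s, k] at *
  linarith

omit hA [IsProbabilityMeasure μ] in
-- The potential weight · (1 − a/2) · err² telescopes; its last value is dropped by sign and its
-- first one is at most 2k err², since k³ + G² ≤ (2k)³.
theorem _root_.MetaStorm.weighted_sum (x₁ : EuclideanSpace ℝ (Fin d)) {w : ℕ → Ξ}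
    (hw : ∀ n x, ‖stochGrad f x (w n)‖ ≤ G) (n : ℕ) :
    letI s := run (stochGrad f) x₁ w
    letI k := 1 + G ^ 2
    ∑ i ∈ Finset.range (n + 1), (s i).err f μ ^ 2 / (s i).root ^ 2 ≤
      4 * k * (s 0).err f μ ^ 2 +
      4 * k ^ 2 * Real.log (1 + (s (n + 1)).sumGrad) +
      4 * k * β ^ 2 * Real.log (1 + (s n).sumDir) +
      2 * ∑ i ∈ Finset.range (n + 1), excess f μ β k (s i) (w (i + 1)) := by
  let s := run (stochGrad f) x₁ w
  let k := 1 + G ^ 2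
  have hk : 1 ≤ k := le_add_of_nonneg_right (sq_nonneg G)
  have h1 : ∀ N, (s N).weight k * (1 - (s N).a 1 / 2) * (s N).err f μ ^ 2 +
      (∑ i ∈ Finset.range N, (s i).err f μ ^ 2 / (s i).root ^ 2) / 2 ≤
      (s 0).weight k * (1 - (s 0).a 1 / 2) * (s 0).err f μ ^ 2 +
      2 * k * (∑ i ∈ Finset.range N,
        ‖stochGrad f (s (i + 1)).x (w (i + 1))‖ ^ 2 / (1 + (s i).sumGrad)) +
      2 * β ^ 2 * k * (∑ i ∈ Finset.range N, ‖(s i).dir‖ ^ 2 / (1 + (s i).sumDir)) +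
      ∑ i ∈ Finset.range N, excess f μ β k (s i) (w (i + 1)) := by
    intro N
    induction N with
    | zero => simp
    | succ N ih =>
      have h := weighted_step (μ := μ) (β := β) x₁ hw N
      simp only [Finset.sum_range_succ]
      linarith
  have hs0 := run_valid (stochGrad f) x₁ w 0
  have hs' := run_valid (stochGrad f) x₁ w (n + 1)
  have h2 : 0 ≤ (s (n + 1)).weight k * (1 - (s (n + 1)).a 1 / 2) * (s (n + 1)).err f μ ^ 2 :=
    mul_nonneg (mul_nonneg (by linarith [hs'.le_weight hk]) (by linarith [hs'.a_le_one]))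
      (sq_nonneg _)
  have h3 : (s 0).weight k ≤ 2 * k := by
    refine le_of_pow_le_pow_left₀ (n := 3) (by norm_num) (by linarith) ?_
    rw [hs0.weight_pow_three hk]
    have h4 : (s 0).sumGrad ≤ G ^ 2 := pow_le_pow_left₀ (norm_nonneg _) (hw 0 x₁) 2
    have h5 : k ≤ k ^ 3 := le_self_pow₀ hk (by norm_num)
    have h6 : G ^ 2 ≤ k := by simp [k]
    have h7 : (2 * k) ^ 3 = 8 * k ^ 3 := by ring
    linarith
  have h4 : (s 0).weight k * (1 - (s 0).a 1 / 2) ≤ 2 * k := by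
    have h5 : (s 0).weight k * (1 - (s 0).a 1 / 2) ≤ (s 0).weight k :=
      mul_le_of_le_one_right (by linarith [hs0.le_weight hk]) (by linarith [hs0.a_nonneg])
    linarith
  have h5 := mul_le_mul_of_nonneg_right h4 (sq_nonneg ((s 0).err f μ))
  have h6 := mul_le_mul_of_nonneg_left (sum_grad_div_le_log (stochGrad f) x₁ w hw n)
    (show 0 ≤ 2 * k by linarith)
  have h7 := mul_le_mul_of_nonneg_left (sum_dir_div_le_log (stochGrad f) x₁ w n)
    (show 0 ≤ 2 * β ^ 2 * k by positivity)
  have h8 := h1 (n + 1)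
  have e1 : 2 * k * ((1 + G ^ 2) * Real.log (1 + (run (stochGrad f) x₁ w (n + 1)).sumGrad)) =
    2 * k ^ 2 * Real.log (1 + (s (n + 1)).sumGrad) := by simp only [k, s]; ring
  rw [e1] at h6
  dsimp only [s, k] at *
  linarith

theorem integral_noise_le (x : EuclideanSpace ℝ (Fin d)) (n : ℕ) :
    ∫ w, ‖stochGrad f x (w n) - gradient (objective f μ) x‖ ^ 2 ∂sampleLaw μ ≤ σ ^ 2 := by
  have h1 : Measurable fun e => ‖stochGrad f x e - gradient (objective f μ) x‖ ^ 2 :=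
    ((hA.measurable_apply x).sub measurable_const).norm.pow_const 2
  have h2 := integral_map (μ := sampleLaw μ) (measurable_pi_apply n).aemeasurable
    (f := fun e => ‖stochGrad f x e - gradient (objective f μ) x‖ ^ 2) h1.aestronglyMeasurable
  rw [sampleLaw_map_eval] at h2
  rw [← h2]
  exact hA.variance_le x

theorem essBdd_noise (hβ : 0 ≤ β) (x₁ : EuclideanSpace ℝ (Fin d)) (n : ℕ) :
    EssBdd (sampleLaw μ) fun w => ‖stochGrad f (run (stochGrad f) x₁ w n).x (w n) -
      gradient (objective f μ) (run (stochGrad f) x₁ w n).x‖ ^ 2 := by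
  have hx := State.measurable_x.comp (hA.measurable_run x₁ n)
  simp only [Function.comp_def] at hx
  have h1 := hA.measurable_grad_comp hx (measurable_pi_apply n)
  have h2 := (hA.measurable_gradient hβ).comp hx
  refine EssBdd.of_le ((h1.sub h2).norm.pow_const 2)
    ((hA.essBdd_norm_grad hx n).add (hA.essBdd_norm_gradient hβ hx)).sq (ae_of_all _ fun w => ?_)
  rw [abs_of_nonneg (sq_nonneg _)]
  exact pow_le_pow_left₀ (norm_nonneg _) (norm_sub_le _ _) 2

/-- The iterate with index n + 1 is computed from the state with index n, which is independent of
sample n + 1. At index 0 the iterate is deterministic. -/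
theorem integral_noise_run_le (hβ : 0 ≤ β) (x₁ : EuclideanSpace ℝ (Fin d)) (n : ℕ) :
    ∫ w, ‖stochGrad f (run (stochGrad f) x₁ w n).x (w n) -
      gradient (objective f μ) (run (stochGrad f) x₁ w n).x‖ ^ 2 ∂sampleLaw μ ≤ σ ^ 2 := by
  cases n with
  | zero => exact hA.integral_noise_le x₁ 0
  | succ n =>
    have hb := hA.essBdd_noise hβ x₁ (n + 1)
    have h3 : Measurable fun z : State d × Ξ =>
        stochGrad f (z.1.nextX 1 1 1 (1 / 2) (1 / 4)) z.2 :=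
      hA.measurable_grad_comp (by fun_prop) measurable_snd
    have h4 := hA.measurable_gradient hβ
    have h6 : Integrable (fun w => ‖stochGrad f
        ((run (stochGrad f) x₁ w n).nextX 1 1 1 (1 / 2) (1 / 4)) (w (n + 1)) - gradient
        (objective f μ) ((run (stochGrad f) x₁ w n).nextX 1 1 1 (1 / 2) (1 / 4))‖ ^ 2 - σ ^ 2)
        (sampleLaw μ) := (hb.sub (EssBdd.const (σ ^ 2))).integrable
    have h5 := integral_run_next_nonpos (μ := μ) hA.measurable_stochGrad x₁ n
      (φ := fun s e => ‖stochGrad f (s.nextX 1 1 1 (1 / 2) (1 / 4)) e -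
        gradient (objective f μ) (s.nextX 1 1 1 (1 / 2) (1 / 4))‖ ^ 2 - σ ^ 2)
      (by fun_prop) h6 (fun s _ => by
        rw [integral_sub _ (integrable_const _)]
        · simpa using hA.variance_le _
        · refine Integrable.of_bound (((hA.measurable_apply _).sub
            measurable_const).norm.pow_const 2).aestronglyMeasurable ((G + G) ^ 2)
            (hA.bounded.mono fun e he => ?_)
          rw [Real.norm_of_nonneg (sq_nonneg _)]
          exact pow_le_pow_left₀ (norm_nonneg _)
            ((norm_sub_le _ _).trans (add_le_add (he _) (hA.norm_gradient_le _))) 2)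
    change ∫ w, (‖stochGrad f (run (stochGrad f) x₁ w (n + 1)).x (w (n + 1)) -
      gradient (objective f μ) (run (stochGrad f) x₁ w (n + 1)).x‖ ^ 2 - σ ^ 2) ∂sampleLaw μ ≤ 0
      at h5
    rw [integral_sub hb.integrable (integrable_const _)] at h5
    simpa using h5

/-- The expected weighted sum of squared errors. -/
theorem integral_sum_err_le (hβ : 0 ≤ β) (x₁ : EuclideanSpace ℝ (Fin d)) (n : ℕ) :
    ∫ w, ∑ i ∈ Finset.range (n + 1), (run (stochGrad f) x₁ w i).err f μ ^ 2 /
        (run (stochGrad f) x₁ w i).root ^ 2 ∂sampleLaw μ ≤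
      4 * (1 + G ^ 2) * σ ^ 2 +
      4 * (1 + G ^ 2) ^ 2 *
        (∫ w, Real.log (1 + (run (stochGrad f) x₁ w (n + 1)).sumGrad) ∂sampleLaw μ) +
      4 * (1 + G ^ 2) * β ^ 2 *
        (∫ w, Real.log (1 + (run (stochGrad f) x₁ w n).sumDir) ∂sampleLaw μ) := by
  have hk : 1 ≤ 1 + G ^ 2 := le_add_of_nonneg_right (sq_nonneg G)
  have b0 := EssBdd.sum (Finset.range (n + 1)) fun i _ => hA.essBdd_err_div hβ x₁ i
  have b1 := (hA.essBdd_err hβ x₁ 0).sq.const_mul (4 * (1 + G ^ 2))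
  have b2 := (hA.essBdd_log_sumGrad x₁ (n + 1)).const_mul (4 * (1 + G ^ 2) ^ 2)
  have b3 := (hA.essBdd_log_sumDir x₁ n).const_mul (4 * (1 + G ^ 2) * β ^ 2)
  have b4 := (EssBdd.sum (Finset.range (n + 1)) fun i _ =>
    hA.essBdd_excess hβ hk x₁ i).const_mul 2
  have h := integral_mono_ae b0.integrable (((b1.add b2).add b3).add b4).integrable
    (hA.ae_bounded.mono fun w hw => weighted_sum (μ := μ) x₁ hw n)
  rw [integral_add ((b1.add b2).add b3).integrable b4.integrable,
    integral_add (b1.add b2).integrable b3.integrable, integral_add b1.integrable b2.integrable,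
    integral_const_mul, integral_const_mul, integral_const_mul, integral_const_mul,
    integral_finsetSum _ fun i _ => (hA.essBdd_excess hβ hk x₁ i).integrable] at h
  have h1 : ∑ i ∈ Finset.range (n + 1), ∫ w, excess f μ β (1 + G ^ 2)
      (run (stochGrad f) x₁ w i) (w (i + 1)) ∂sampleLaw μ ≤ 0 :=
    Finset.sum_nonpos fun i _ => hA.integral_excess_run_nonpos hβ hk x₁ i
  -- The first direction is a single stochastic gradient, so its error is plain noise.
  have h2 : ∫ w, (run (stochGrad f) x₁ w 0).err f μ ^ 2 ∂sampleLaw μ ≤ σ ^ 2 :=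
    hA.integral_noise_le x₁ 0
  have h3 := mul_le_mul_of_nonneg_left h2 (show 0 ≤ 4 * (1 + G ^ 2) by linarith)
  linarith

end Assumptions

end Expectation

end

section

/-! ### Comparisons with κ₂. -/

section Constants

variable {β G : ℝ}

theorem one_add_sq_le_kappa₂ : 1 + G ^ 2 ≤ kappa₂ β G :=
  le_mul_of_one_le_right (by positivity) (le_max_right _ _)

theorem one_le_kappa₂ : 1 ≤ kappa₂ β G :=
  le_trans (le_add_of_nonneg_right (sq_nonneg G)) one_add_sq_le_kappa₂

theorem le_kappa₂ (hβ : 0 ≤ β) : β ≤ kappa₂ β G :=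
  (le_max_left β 1).trans (le_mul_of_one_le_left (hβ.trans (le_max_left β 1))
    (le_add_of_nonneg_right (sq_nonneg G)))

theorem mul_sq_le_kappa₂_sq (hβ : 0 ≤ β) : (1 + G ^ 2) * β ^ 2 ≤ kappa₂ β G ^ 2 := by
  rw [kappa₂, mul_pow]
  exact mul_le_mul (le_self_pow₀ (le_add_of_nonneg_right (sq_nonneg G)) (by norm_num))
    (pow_le_pow_left₀ hβ (le_max_left _ _) 2) (sq_nonneg _) (by positivity)

end Constants

/-! ### Pathwise bounds and cube roots. -/

theorem rpow_third_pow_three {x : ℝ} (hx : 0 ≤ x) : (x ^ (1 / 3 : ℝ)) ^ 3 = x := by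
  rw [← Real.rpow_natCast, ← Real.rpow_mul hx]
  norm_num

theorem norm_sq_le_two_mul_add {E : Type*} [SeminormedAddCommGroup E] (a b : E) :
    ‖a‖ ^ 2 ≤ 2 * ‖b‖ ^ 2 + 2 * ‖a - b‖ ^ 2 := by
  have h2 : ‖a‖ ≤ ‖b‖ + ‖a - b‖ := by
    calc ‖a‖ = ‖b + (a - b)‖ := by rw [add_sub_cancel]
      _ ≤ _ := norm_add_le _ _
  nlinarith [pow_le_pow_left₀ (norm_nonneg _) h2 2, sq_nonneg (‖b‖ - ‖a - b‖)]

variable {d : ℕ} {Ξ : Type*}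

/-- Because 1 + sumDir = rad² and 1 + sumGrad = root⁶, the logarithm in the descent bound returns to
log(rad / root), which can be absorbed. -/
theorem log_one_add_sumDir_eq {s : State d} (hs : s.Valid) :
    Real.log (1 + s.sumDir) = 2 * Real.log (s.rad / s.root) + Real.log (1 + s.sumGrad) / 3 := by
  rw [← hs.rad_sq, ← hs.root_pow_six, Real.log_pow, Real.log_pow,
    Real.log_div hs.rad_pos.ne' hs.root_pos.ne']
  push_cast
  ring

variable [MeasurableSpace Ξ] {f : EuclideanSpace ℝ (Fin d) → Ξ → ℝ}
  {μ : Measure Ξ} [IsProbabilityMeasure μ] {σ β G : ℝ}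

/-- The sum of the squared norms of the gradients at the iterates up to index `n`. -/
def sumSqGradient (f : EuclideanSpace ℝ (Fin d) → Ξ → ℝ) (μ : Measure Ξ)
    (x₁ : EuclideanSpace ℝ (Fin d)) (n : ℕ) (w : ℕ → Ξ) : ℝ :=
  ∑ i ∈ Finset.range (n + 1), ‖gradient (objective f μ) (run (stochGrad f) x₁ w i).x‖ ^ 2

/-- The sum of the weighted squared errors of the gradient estimates up to index `n`. -/
def sumErr (f : EuclideanSpace ℝ (Fin d) → Ξ → ℝ) (μ : Measure Ξ)
    (x₁ : EuclideanSpace ℝ (Fin d)) (n : ℕ) (w : ℕ → Ξ) : ℝ :=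
  ∑ i ∈ Finset.range (n + 1), (run (stochGrad f) x₁ w i).err f μ ^ 2 /
    (run (stochGrad f) x₁ w i).root ^ 2

omit [IsProbabilityMeasure μ] in
theorem sumSqGradient_nonneg (x₁ : EuclideanSpace ℝ (Fin d)) (n : ℕ) (w : ℕ → Ξ) :
    0 ≤ sumSqGradient f μ x₁ n w := Finset.sum_nonneg fun _ _ => sq_nonneg _

omit [IsProbabilityMeasure μ] in
theorem sumErr_nonneg (x₁ : EuclideanSpace ℝ (Fin d)) (n : ℕ) (w : ℕ → Ξ) :
    0 ≤ sumErr f μ x₁ n w := Finset.sum_nonneg fun _ _ => by positivity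

omit [IsProbabilityMeasure μ] in
theorem sumSqGradient_le (x₁ : EuclideanSpace ℝ (Fin d)) (n : ℕ) (w : ℕ → Ξ) :
    sumSqGradient f μ x₁ n w ≤ 2 * (run (stochGrad f) x₁ w n).root ^ 2 *
      (((run (stochGrad f) x₁ w n).rad / (run (stochGrad f) x₁ w n).root) ^ 2 +
        sumErr f μ x₁ n w) := by
  have hv := run_valid (stochGrad f) x₁ w n
  have hr := hv.root_pos
  have h1 : sumSqGradient f μ x₁ n w ≤ 2 * (run (stochGrad f) x₁ w n).sumDir +
      2 * ∑ i ∈ Finset.range (n + 1), (run (stochGrad f) x₁ w i).err f μ ^ 2 := by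
    rw [run_sumDir, Finset.mul_sum, Finset.mul_sum, ← Finset.sum_add_distrib]
    refine Finset.sum_le_sum fun i _ => ?_
    set s := run (stochGrad f) x₁ w i
    rw [State.err, norm_sub_rev]
    exact norm_sq_le_two_mul_add _ _
  have h2 : ∑ i ∈ Finset.range (n + 1), (run (stochGrad f) x₁ w i).err f μ ^ 2 ≤
      (run (stochGrad f) x₁ w n).root ^ 2 * sumErr f μ x₁ n w := by
    rw [sumErr, Finset.mul_sum]
    refine Finset.sum_le_sum fun i hi => ?_
    have hin : i ≤ n := by simpa [Nat.lt_succ_iff] using hi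
    have hri := (run_valid (stochGrad f) x₁ w i).root_pos
    rw [mul_div_assoc', le_div_iff₀ (by positivity), mul_comm]
    exact mul_le_mul_of_nonneg_right
      (pow_le_pow_left₀ hri.le (run_root_mono (stochGrad f) x₁ w hin) 2) (sq_nonneg _)
  have h3 : (run (stochGrad f) x₁ w n).sumDir ≤ (run (stochGrad f) x₁ w n).root ^ 2 *
      ((run (stochGrad f) x₁ w n).rad / (run (stochGrad f) x₁ w n).root) ^ 2 := by
    rw [div_pow, mul_div_cancel₀ _ (by positivity), hv.rad_sq]
    linarith
  linarith

/-- Here u is root², while x³ and y³ are the sums of squared gradients and of squared noise. Only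
the mean of y³ is known, hence the linearisation y ≤ S + y³ / S². -/
theorem add_third_roots_bound {u x y S : ℝ} (hS : 0 < S) (hx : 0 ≤ x) (hy : 0 ≤ y)
    (h : u ^ 3 ≤ 1 + 2 * x ^ 3 + 2 * y ^ 3) :
    u ≤ 1 + 2 * S + 2 * x + 2 * (S ^ 2)⁻¹ * y ^ 3 := by
  have h5 : u ≤ 1 + 2 * x + 2 * y := by
    refine le_of_pow_le_pow_left₀ (n := 3) (by norm_num) (by positivity) (h.trans ?_)
    have h7 : (1 + 2 * x + 2 * y) ^ 3 = 1 + 8 * x ^ 3 + 8 * y ^ 3 + (6 * x + 6 * y +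
      12 * x ^ 2 + 24 * x * y + 12 * y ^ 2 + 24 * x ^ 2 * y + 24 * x * y ^ 2) := by ring
    have h8 : 0 ≤ 6 * x + 6 * y +
      12 * x ^ 2 + 24 * x * y + 12 * y ^ 2 + 24 * x ^ 2 * y + 24 * x * y ^ 2 := by
      positivity
    have h9 : 0 ≤ x ^ 3 := by positivity
    have h10 : 0 ≤ y ^ 3 := by positivity
    linarith
  have h6 : y ≤ S + (S ^ 2)⁻¹ * y ^ 3 := by
    rcases le_total y S with h7 | h7
    · have : 0 ≤ (S ^ 2)⁻¹ * y ^ 3 := by positivity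
      linarith
    · have h8 : y ≤ (S ^ 2)⁻¹ * y ^ 3 := by
        rw [inv_mul_eq_div, le_div_iff₀ (by positivity)]
        nlinarith [pow_le_pow_left₀ hS.le h7 2]
      linarith
  linarith

theorem two_mul_mul_le_cube {u x y : ℝ} (hu : 0 ≤ u) (hx : 0 ≤ x) (hy : 0 ≤ y) :
    2 * (u * (x ^ 2 + y)) ≤ (2 * (u + x + y + 1)) ^ 3 := by
  have h1 : x ^ 2 + y ≤ (u + x + y + 1) ^ 2 := by
    nlinarith [mul_nonneg hu hx, mul_nonneg hu hy, mul_nonneg hx hy, sq_nonneg u, sq_nonneg y]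
  have h2 : u ≤ u + x + y + 1 := by linarith
  have h3 := mul_le_mul h2 h1 (by positivity) (by positivity)
  nlinarith [show 0 ≤ (u + x + y + 1) ^ 3 by positivity]

/-- Dividing U, X, Y by the expected scales U₀, B, B² leaves a right-hand side linear in each of
them, so no joint moments are needed. -/
theorem rpow_third_le_of_le {H U U₀ X Y B : ℝ} (hU₀ : 0 < U₀) (hB : 0 < B)
    (hU : 0 ≤ U) (hX : 0 ≤ X) (hY : 0 ≤ Y) (hH : 0 ≤ H) (h : H ≤ 2 * U * (X ^ 2 + Y)) :
    H ^ (1 / 3 : ℝ) ≤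
      (U₀ * B ^ 2) ^ (1 / 3 : ℝ) * (2 * (U / U₀ + X / B + Y / B ^ 2 + 1)) := by
  refine le_of_pow_le_pow_left₀ (n := 3) (by norm_num) (by positivity) ?_
  rw [mul_pow, rpow_third_pow_three hH, rpow_third_pow_three (by positivity)]
  have h1 := two_mul_mul_le_cube (div_nonneg hU hU₀.le) (div_nonneg hX hB.le)
    (div_nonneg hY (sq_nonneg B))
  have h2 := mul_le_mul_of_nonneg_left h1 (show 0 ≤ U₀ * B ^ 2 by positivity)
  refine le_trans (h.trans (le_of_eq ?_)) h2
  field_simp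

/-! ### First-moment bounds. -/

namespace Assumptions

variable (hA : Assumptions f μ σ β G)
include hA

theorem essBdd_rad_div_root (x₁ : EuclideanSpace ℝ (Fin d)) (n : ℕ) :
    EssBdd (sampleLaw μ) fun w =>
      (run (stochGrad f) x₁ w n).rad / (run (stochGrad f) x₁ w n).root := by
  have := hA.measurable_run x₁ n
  refine EssBdd.of_le (by fun_prop) (hA.essBdd_rad x₁ n) (ae_of_all _ fun w => ?_)
  have h := run_valid (stochGrad f) x₁ w n
  rw [abs_of_pos (div_pos h.rad_pos h.root_pos)]
  exact div_le_self h.rad_pos.le h.one_le_root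

theorem essBdd_sumErr (hβ : 0 ≤ β) (x₁ : EuclideanSpace ℝ (Fin d)) (n : ℕ) :
    EssBdd (sampleLaw μ) (sumErr f μ x₁ n) :=
  EssBdd.sum _ fun i _ => hA.essBdd_err_div hβ x₁ i

theorem essBdd_sumSqGradient_rpow (hβ : 0 ≤ β) (x₁ : EuclideanSpace ℝ (Fin d)) (n : ℕ) :
    EssBdd (sampleLaw μ) fun w => sumSqGradient f μ x₁ n w ^ (1 / 3 : ℝ) := by
  have hx : ∀ i, Measurable fun w => (run (stochGrad f) x₁ w i).x := fun i =>
    State.measurable_x.comp (hA.measurable_run x₁ i)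
  have h1 : EssBdd (sampleLaw μ) (sumSqGradient f μ x₁ n) :=
    EssBdd.sum _ fun i _ => (hA.essBdd_norm_gradient hβ (hx i)).sq
  have h2 : Measurable (sumSqGradient f μ x₁ n) :=
    Finset.measurable_fun_sum _ fun i _ =>
      ((hA.measurable_gradient hβ).comp (hx i)).norm.pow_const 2
  refine EssBdd.of_le (h2.pow_const _) ((EssBdd.const 1).add h1) (ae_of_all _ fun w => ?_)
  have h0 := sumSqGradient_nonneg (f := f) (μ := μ) x₁ n w
  rw [abs_of_nonneg (Real.rpow_nonneg h0 _)]
  refine (Real.rpow_le_rpow h0 (le_add_of_nonneg_left zero_le_one)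
    (by norm_num)).trans ?_
  exact (Real.rpow_le_rpow_of_exponent_le (by linarith) (by norm_num)).trans_eq
    (Real.rpow_one _)

/-- First moments of the normalized sums of directions and of errors, in terms of the expected
logarithm of the accumulated stochastic gradients. -/
theorem integral_moments_le (hβ : 0 ≤ β) (x₁ : EuclideanSpace ℝ (Fin d)) (n : ℕ) {κ B : ℝ}
    (hκ : κ = kappa₂ β G)
    (hB : B = 1 + (objective f μ x₁ - ⨅ x, objective f μ x) + σ ^ 2 + κ * Real.log (14 * κ) +
      κ * ∫ w, Real.log (1 + (run (stochGrad f) x₁ w (n + 1)).sumGrad) ∂sampleLaw μ) :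
    κ ≤ B ∧
    ∫ w, (run (stochGrad f) x₁ w n).rad / (run (stochGrad f) x₁ w n).root ∂sampleLaw μ ≤ 14 * B ∧
    ∫ w, sumErr f μ x₁ n w ∂sampleLaw μ ≤ 24 * B ^ 2 := by
  have hκ1 : 1 ≤ κ := hκ ▸ one_le_kappa₂
  have hκ0 : 0 < κ := by linarith
  have hkκ : 1 + G ^ 2 ≤ κ := hκ ▸ one_add_sq_le_kappa₂
  have hβκ : β ≤ κ := hκ ▸ le_kappa₂ hβ
  have hkβ : (1 + G ^ 2) * β ^ 2 ≤ κ ^ 2 := hκ ▸ mul_sq_le_kappa₂_sq hβ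
  have hkk : (1 + G ^ 2) ^ 2 ≤ κ ^ 2 := pow_le_pow_left₀ (by positivity) hkκ 2
  have hmin : ∀ x, ⨅ x, objective f μ x ≤ objective f μ x := fun x => ciInf_le hA.bddBelow x
  have hΔ := hmin x₁
  set Δ := objective f μ x₁ - ⨅ x, objective f μ x with hΔdef
  have bX := hA.essBdd_rad_div_root x₁ n
  have bY := hA.essBdd_sumErr hβ x₁ n
  have bD := hA.essBdd_log_sumDir x₁ n
  have bG := hA.essBdd_log_sumGrad x₁ (n + 1)
  have hY := hA.integral_sum_err_le hβ x₁ n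
  change ∫ w, sumErr f μ x₁ n w ∂sampleLaw μ ≤ _ at hY
  have hX : ∫ w, (run (stochGrad f) x₁ w n).rad / (run (stochGrad f) x₁ w n).root ∂sampleLaw μ ≤
      1 + Δ + (∫ w, sumErr f μ x₁ n w ∂sampleLaw μ) / (2 * κ) + (κ / 2 + β) *
        ∫ w, Real.log (1 + (run (stochGrad f) x₁ w n).sumDir) ∂sampleLaw μ := by
    have bR := ((EssBdd.const (P := sampleLaw μ) (1 + Δ)).add (bY.const_mul (2 * κ)⁻¹))
    have h := integral_mono bX.integrable (bR.add (bD.const_mul (κ / 2 + β))).integrable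
      (fun w => by
        have h := descent_sum (g := stochGrad f) hβ hκ0 hA.hasGradientAt
          (hA.lipschitz_gradient hβ) hmin x₁ w n
        rw [div_eq_inv_mul _ (2 * κ)] at h
        exact h)
    rw [integral_add bR.integrable (bD.const_mul (κ / 2 + β)).integrable,
      integral_add (integrable_const _) (bY.const_mul (2 * κ)⁻¹).integrable,
      integral_const_mul, integral_const_mul] at h
    simp only [integral_const, probReal_univ, smul_eq_mul, one_mul] at h
    rwa [div_eq_inv_mul]
  -- Tangent of log at 14κ: the bounds `hX` and `hY2` together contain (7/2) κ LD, which contributes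
  -- EX / 2 and is absorbed in `hEX`.
  have hD : ∫ w, Real.log (1 + (run (stochGrad f) x₁ w n).sumDir) ∂sampleLaw μ ≤
      (7 * κ)⁻¹ * (∫ w, (run (stochGrad f) x₁ w n).rad / (run (stochGrad f) x₁ w n).root
        ∂sampleLaw μ) + 2 * Real.log (14 * κ) +
      3⁻¹ * ∫ w, Real.log (1 + (run (stochGrad f) x₁ w (n + 1)).sumGrad) ∂sampleLaw μ := by
    have bR := (bX.const_mul (7 * κ)⁻¹).add (EssBdd.const (2 * Real.log (14 * κ)))
    have h := integral_mono bD.integrable (bR.add (bG.const_mul 3⁻¹)).integrable (fun w => by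
      have hv := run_valid (stochGrad f) x₁ w n
      have hG0 := hv.1
      have h1 := log_le_div_add_log (div_pos hv.rad_pos hv.root_pos)
        (show 0 < 14 * κ by positivity)
      have h2 : Real.log (1 + (run (stochGrad f) x₁ w n).sumGrad) ≤
          Real.log (1 + (run (stochGrad f) x₁ w (n + 1)).sumGrad) :=
        Real.log_le_log (by linarith) (by
          have := run_sumGrad_mono (stochGrad f) x₁ w n.le_succ
          simp only at this
          linarith)
      have h3 : (run (stochGrad f) x₁ w n).rad / (run (stochGrad f) x₁ w n).root / (14 * κ) =
          (7 * κ)⁻¹ * ((run (stochGrad f) x₁ w n).rad / (run (stochGrad f) x₁ w n).root) / 2 := by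
        rw [div_eq_inv_mul, show (14 * κ)⁻¹ = (7 * κ)⁻¹ * 2⁻¹ by rw [← mul_inv]; ring_nf]
        ring
      simp only
      rw [log_one_add_sumDir_eq hv]
      linarith)
    rw [integral_add bR.integrable (bG.const_mul 3⁻¹).integrable,
      integral_add (bX.const_mul (7 * κ)⁻¹).integrable (integrable_const _),
      integral_const_mul (7 * κ)⁻¹, integral_const_mul 3⁻¹] at h
    simp only [integral_const, probReal_univ, smul_eq_mul, one_mul] at h
    exact h
  have hLG : 0 ≤ ∫ w, Real.log (1 + (run (stochGrad f) x₁ w (n + 1)).sumGrad) ∂sampleLaw μ :=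
    integral_nonneg fun w => Real.log_nonneg (by
      linarith [(run_valid (stochGrad f) x₁ w (n + 1)).1])
  have hLD : 0 ≤ ∫ w, Real.log (1 + (run (stochGrad f) x₁ w n).sumDir) ∂sampleLaw μ :=
    integral_nonneg fun w => Real.log_nonneg (by linarith [(run_valid (stochGrad f) x₁ w n).2])
  set LG := ∫ w, Real.log (1 + (run (stochGrad f) x₁ w (n + 1)).sumGrad) ∂sampleLaw μ
  set LD := ∫ w, Real.log (1 + (run (stochGrad f) x₁ w n).sumDir) ∂sampleLaw μ
  set EX := ∫ w, (run (stochGrad f) x₁ w n).rad / (run (stochGrad f) x₁ w n).root ∂sampleLaw μ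
  set EY := ∫ w, sumErr f μ x₁ n w ∂sampleLaw μ
  have hlog : 1 ≤ Real.log (14 * κ) := by
    rw [Real.le_log_iff_exp_le (by positivity)]
    linarith [Real.exp_one_lt_d9]
  have hκlog : κ ≤ κ * Real.log (14 * κ) := le_mul_of_one_le_right hκ0.le hlog
  have hκLG : 0 ≤ κ * LG := mul_nonneg hκ0.le hLG
  have hσ := sq_nonneg σ
  have hΔ0 : 0 ≤ Δ := sub_nonneg.2 hΔ
  have hz : κ * LD ≤ EX / 7 + 2 * (κ * Real.log (14 * κ)) + κ * LG / 3 := by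
    have h := mul_le_mul_of_nonneg_left hD hκ0.le
    refine h.trans (le_of_eq ?_)
    field_simp
  have hY' : EY ≤ κ * (4 * σ ^ 2 + 4 * (κ * LG) + 4 * (κ * LD)) := by
    have h1 := mul_le_mul_of_nonneg_right hkκ hσ
    have h2 := mul_le_mul_of_nonneg_right hkk hLG
    have h3 := mul_le_mul_of_nonneg_right hkβ hLD
    nlinarith
  have hY2 : EY / (2 * κ) ≤ 2 * σ ^ 2 + 2 * (κ * LG) + 2 * (κ * LD) := by
    rw [div_le_iff₀ (by positivity)]
    linarith
  have hβLD := mul_le_mul_of_nonneg_right hβκ hLD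
  have hEX : EX ≤ 14 * B := by linarith
  refine ⟨by linarith, hEX, hY'.trans ?_⟩
  have hB0 : 0 ≤ B := by linarith
  have h5 : 4 * σ ^ 2 + 4 * (κ * LG) + 4 * (κ * LD) ≤ 24 * B := by linarith
  calc _ ≤ κ * (24 * B) := mul_le_mul_of_nonneg_left h5 hκ0.le
    _ ≤ B * (24 * B) := mul_le_mul_of_nonneg_right (by linarith) (by linarith)
    _ = _ := by ring

/-- The constant is 80 = 2 (1 + 14 + 24 + 1), from the means of the normalised quantities. -/
theorem integral_sumSqGradient_rpow_le (hβ : 0 ≤ β) (x₁ : EuclideanSpace ℝ (Fin d)) (n : ℕ)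
    {U₀ B : ℝ} (hU₀ : 0 < U₀) (hB : 0 < B)
    (hU : ∫ w, (run (stochGrad f) x₁ w n).root ^ 2 ∂sampleLaw μ ≤ U₀)
    (hX : ∫ w, (run (stochGrad f) x₁ w n).rad / (run (stochGrad f) x₁ w n).root ∂sampleLaw μ ≤
      14 * B)
    (hY : ∫ w, sumErr f μ x₁ n w ∂sampleLaw μ ≤ 24 * B ^ 2) :
    ∫ w, sumSqGradient f μ x₁ n w ^ (1 / 3 : ℝ) ∂sampleLaw μ ≤
      80 * (U₀ * B ^ 2) ^ (1 / 3 : ℝ) := by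
  set c := (U₀ * B ^ 2) ^ (1 / 3 : ℝ) with hc
  have bU := (hA.essBdd_root x₁ n).sq.const_mul U₀⁻¹
  have bX := (hA.essBdd_rad_div_root x₁ n).const_mul B⁻¹
  have bY := (hA.essBdd_sumErr hβ x₁ n).const_mul (B ^ 2)⁻¹
  have b := (((bU.add bX).add bY).add (EssBdd.const 1)).const_mul (c * 2)
  have h := integral_mono (hA.essBdd_sumSqGradient_rpow hβ x₁ n).integrable b.integrable
    (fun w => by
      have hv := run_valid (stochGrad f) x₁ w n
      have h := rpow_third_le_of_le hU₀ hB (sq_nonneg (run (stochGrad f) x₁ w n).root)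
        (div_pos hv.rad_pos hv.root_pos).le (sumErr_nonneg x₁ n w)
        (sumSqGradient_nonneg x₁ n w) (sumSqGradient_le (f := f) (μ := μ) x₁ n w)
      simp only
      refine h.trans (le_of_eq ?_)
      rw [← hc]
      ring)
  rw [integral_const_mul, integral_add ((bU.add bX).add bY).integrable (integrable_const _),
    integral_add (bU.add bX).integrable bY.integrable, integral_add bU.integrable bX.integrable,
    integral_const_mul, integral_const_mul, integral_const_mul] at h
  simp only [integral_const, probReal_univ, smul_eq_mul, one_mul] at h
  have h1 := mul_le_mul_of_nonneg_left hU (inv_nonneg.2 hU₀.le)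
  have h2 := mul_le_mul_of_nonneg_left hX (inv_nonneg.2 hB.le)
  have h3 := mul_le_mul_of_nonneg_left hY (inv_nonneg.2 (sq_nonneg B))
  rw [inv_mul_cancel₀ hU₀.ne'] at h1
  rw [show B⁻¹ * (14 * B) = 14 by field_simp] at h2
  rw [show (B ^ 2)⁻¹ * (24 * B ^ 2) = 24 by field_simp] at h3
  have hc0 : 0 ≤ c := by positivity
  refine h.trans ?_
  have h4 := mul_le_mul_of_nonneg_left (add_le_add (add_le_add (add_le_add h1 h2) h3)
    (le_refl (1 : ℝ))) (show 0 ≤ c * 2 by positivity)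
  linarith

/-- Each stochastic gradient is split into gradient and noise; the accumulated squared noise has
mean at most S³, and its linearised cube root contributes 4S. -/
theorem integral_root_sq_le (hβ : 0 ≤ β) (x₁ : EuclideanSpace ℝ (Fin d)) (n : ℕ)
    {S : ℝ} (hS : 0 < S) (hS3 : S ^ 3 = σ ^ 2 * (n + 1 : ℕ)) :
    ∫ w, (run (stochGrad f) x₁ w n).root ^ 2 ∂sampleLaw μ ≤
      1 + 2 * (∫ w, sumSqGradient f μ x₁ n w ^ (1 / 3 : ℝ) ∂sampleLaw μ) + 4 * S := by
  set N : (ℕ → Ξ) → ℝ := fun w => ∑ i ∈ Finset.range (n + 1),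
    ‖stochGrad f (run (stochGrad f) x₁ w i).x (w i) -
      gradient (objective f μ) (run (stochGrad f) x₁ w i).x‖ ^ 2 with hN
  have bN : EssBdd (sampleLaw μ) N := EssBdd.sum _ fun i _ => hA.essBdd_noise hβ x₁ i
  have eN : ∫ w, N w ∂sampleLaw μ ≤ S ^ 3 := by
    rw [hN, integral_finsetSum _ fun i _ => (hA.essBdd_noise hβ x₁ i).integrable]
    refine (Finset.sum_le_sum fun i _ => hA.integral_noise_run_le hβ x₁ i).trans (le_of_eq ?_)
    rw [Finset.sum_const, Finset.card_range, nsmul_eq_mul, hS3]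
    ring
  have bH := (hA.essBdd_sumSqGradient_rpow hβ x₁ n).const_mul 2
  have bR := (EssBdd.const (P := sampleLaw μ) (1 + 2 * S)).add bH
  have bN' := bN.const_mul (2 * (S ^ 2)⁻¹)
  have h := integral_mono (hA.essBdd_root x₁ n).sq.integrable (bR.add bN').integrable
    (fun w => by
      have hv := run_valid (stochGrad f) x₁ w n
      have hH0 := sumSqGradient_nonneg (f := f) (μ := μ) x₁ n w
      have hN0 : 0 ≤ N w := Finset.sum_nonneg fun _ _ => sq_nonneg _
      have h1 : (run (stochGrad f) x₁ w n).sumGrad ≤ 2 * sumSqGradient f μ x₁ n w + 2 * N w := by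
        rw [run_sumGrad, sumSqGradient, hN, Finset.mul_sum, Finset.mul_sum,
          ← Finset.sum_add_distrib]
        refine Finset.sum_le_sum fun i _ => ?_
        exact norm_sq_le_two_mul_add _ _
      have h3 := rpow_third_pow_three hH0
      have h4 := rpow_third_pow_three hN0
      have h5 := add_third_roots_bound (u := (run (stochGrad f) x₁ w n).root ^ 2) hS
        (Real.rpow_nonneg hH0 (1 / 3)) (Real.rpow_nonneg hN0 (1 / 3)) (by
          rw [← pow_mul, hv.root_pow_six, h3, h4]
          linarith)
      rw [h4] at h5
      simp only
      linarith)
  rw [integral_add bR.integrable bN'.integrable, integral_add (integrable_const _) bH.integrable,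
    integral_const_mul, integral_const_mul] at h
  simp only [integral_const, probReal_univ, smul_eq_mul, one_mul] at h
  have h1 := mul_le_mul_of_nonneg_left eN (show 0 ≤ 2 * (S ^ 2)⁻¹ by positivity)
  rw [show 2 * (S ^ 2)⁻¹ * S ^ 3 = 2 * S by field_simp] at h1
  linarith

/-- Jensen's inequality through the tangent at U₀. Passing from index n + 1 to n costs log(1 + G²),
and the factor 3 comes from 1 + sumGrad = (root²)³. -/
theorem integral_log_sumGrad_le (x₁ : EuclideanSpace ℝ (Fin d)) (n : ℕ)
    {U₀ : ℝ} (hU₀ : 0 < U₀)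
    (hU : ∫ w, (run (stochGrad f) x₁ w n).root ^ 2 ∂sampleLaw μ ≤ U₀) :
    ∫ w, Real.log (1 + (run (stochGrad f) x₁ w (n + 1)).sumGrad) ∂sampleLaw μ ≤
      Real.log (1 + G ^ 2) + 3 * Real.log U₀ := by
  have bU := (hA.essBdd_root x₁ n).sq.const_mul (3 * U₀⁻¹)
  have h := integral_mono_ae (hA.essBdd_log_sumGrad x₁ (n + 1)).integrable
    ((EssBdd.const (Real.log (1 + G ^ 2) + 3 * Real.log U₀ - 3)).add bU).integrable
    (hA.ae_bounded.mono fun w hw => by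
      have hv := run_valid (stochGrad f) x₁ w n
      have hr := hv.root_pos
      have hG0 := hv.1
      have h1 : 1 + (run (stochGrad f) x₁ w (n + 1)).sumGrad ≤
          (1 + G ^ 2) * (1 + (run (stochGrad f) x₁ w n).sumGrad) := by
        rw [run_succ_sumGrad]
        have hg : ‖stochGrad f (run (stochGrad f) x₁ w (n + 1)).x (w (n + 1))‖ ^ 2 ≤ G ^ 2 :=
          pow_le_pow_left₀ (norm_nonneg _) (hw _ _) 2
        nlinarith [mul_nonneg (sq_nonneg G) hG0]
      have h2 := Real.log_le_log (by linarith [(run_valid (stochGrad f) x₁ w (n + 1)).1]) h1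
      rw [Real.log_mul (by positivity) (by linarith), ← hv.root_pow_six,
        show 6 = 2 * 3 from rfl, pow_mul, Real.log_pow] at h2
      have h3 := log_le_div_add_log (pow_pos hr 2) hU₀
      rw [div_eq_inv_mul] at h3
      push_cast at h2
      linarith)
  rw [integral_add (integrable_const _) bU.integrable, integral_const_mul] at h
  simp only [integral_const, probReal_univ, smul_eq_mul, one_mul] at h
  have h1 := mul_le_mul_of_nonneg_left hU (show 0 ≤ 3 * U₀⁻¹ by positivity)
  rw [mul_assoc 3 U₀⁻¹ U₀, inv_mul_cancel₀ hU₀.ne'] at h1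
  linarith

end Assumptions

end

section

/-! ### Solution of the self-bounding inequalities. -/

theorem log_six_thousand_le : Real.log 6000 ≤ 9 := by
  rw [Real.log_le_iff_le_exp (by norm_num)]
  have h := pow_le_pow_left₀ (by norm_num) Real.exp_one_gt_d9.le 9
  rw [← Real.exp_nat_mul] at h
  norm_num at h ⊢
  linarith

theorem log_fourteen_le : Real.log 14 ≤ 3 := by
  rw [Real.log_le_iff_le_exp (by norm_num)]
  have h := pow_le_pow_left₀ (by norm_num) Real.exp_one_gt_d9.le 3
  rw [← Real.exp_nat_mul] at h
  norm_num at h ⊢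
  linarith

/-- Solving the self-bounding inequalities between the expected cube root of the sum of squared
gradients and the expected logarithm of the accumulated stochastic gradients. -/
theorem self_bounding_solution {Δ σ G κ κ₁ h L S B : ℝ} (hΔ : 0 ≤ Δ) (hκ : 1 ≤ κ)
    (hκ₁ : κ₁ = Δ + σ ^ 2 + G ^ 2 + κ * Real.log κ) (hS : 10 * (1 + κ₁) ≤ S)
    (hB : B = 1 + Δ + σ ^ 2 + κ * Real.log (14 * κ) + κ * L) (hB0 : 0 < B) (h0 : 0 ≤ h)
    (hL : L ≤ Real.log κ + 3 * Real.log (1 + 2 * h + 4 * S))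
    (hh : h ≤ 80 * ((1 + 2 * h + 4 * S) * B ^ 2) ^ (1 / 3 : ℝ)) :
    h ^ 3 ≤ 10 ^ 15 * ((κ₁ + κ * Real.log (1 + S ^ 3)) ^ 2 * S) := by
  have hκ0 : 0 < κ := by linarith
  have hlogκ : 0 ≤ Real.log κ := Real.log_nonneg hκ
  have hσ := sq_nonneg σ
  have hG := sq_nonneg G
  have hκlog : κ ≤ 1 + κ * Real.log κ := by
    have h1 := Real.one_sub_inv_le_log_of_pos hκ0
    have h2 := mul_le_mul_of_nonneg_left h1 hκ0.le
    rw [mul_sub, mul_one, mul_inv_cancel₀ hκ0.ne'] at h2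
    linarith
  have hκlog0 : 0 ≤ κ * Real.log κ := mul_nonneg hκ0.le hlogκ
  have hκκ₁ : κ ≤ 1 + κ₁ := by linarith
  have hκ₁0 : 0 ≤ κ₁ := by linarith
  have hS10 : 10 ≤ S := by linarith
  have hSκ : 10 * κ ≤ S := by linarith
  have hS0 : 0 < S := by linarith
  -- Otherwise B ≤ U / 6000 and, as 320³ < 6000², h ≤ 80 · U / 320 = U / 4; then U ≤ 2 + 8S ≤ 9S, a
  -- contradiction.
  have hU : 1 + 2 * h + 4 * S ≤ 9 * S + 6000 * B := by
    by_contra! hcon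
    set U := 1 + 2 * h + 4 * S with hUdef
    have hU0 : 0 < U := by positivity
    have h1 : (U * B ^ 2) ^ (1 / 3 : ℝ) ≤ U / 320 := by
      refine le_of_pow_le_pow_left₀ (n := 3) (by norm_num) (by positivity) ?_
      rw [rpow_third_pow_three (by positivity)]
      have h2 : B ≤ U / 6000 := by linarith
      have h3 := mul_le_mul_of_nonneg_left (pow_le_pow_left₀ hB0.le h2 2) hU0.le
      refine h3.trans ?_
      have h4 : 0 < U ^ 3 := by positivity
      calc U * (U / 6000) ^ 2 = U ^ 3 / 36000000 := by ring
        _ ≤ U ^ 3 / 32768000 := by gcongr; norm_num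
        _ = _ := by ring
    linarith
  have hU0 : 0 < 1 + 2 * h + 4 * S := by positivity
  have hlogU : Real.log (1 + 2 * h + 4 * S) ≤ 9 + Real.log S + B / S := by
    have h1 := log_le_div_add_log hU0 (show 0 < 6000 * S by positivity)
    rw [Real.log_mul (by norm_num) hS0.ne'] at h1
    have h2 : (1 + 2 * h + 4 * S) / (6000 * S) ≤ 1 + B / S := by
      rw [div_le_iff₀ (by positivity), add_mul, div_mul_eq_mul_div,
        show B * (6000 * S) / S = 6000 * B by field_simp]
      linarith
    linarith [log_six_thousand_le]
  -- The bound for κL contains 3κB / S ≤ 3B / 10, because S ≥ 10κ; it moves to the left-hand side.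
  have hBM : B ≤ 2 + 4 * κ₁ + 60 * κ + 6 * (κ * Real.log S) := by
    have h1 := mul_le_mul_of_nonneg_left (hL.trans (add_le_add le_rfl
      (mul_le_mul_of_nonneg_left hlogU (by norm_num)))) hκ0.le
    have h2 : κ * (B / S) ≤ B / 10 := by
      rw [mul_div_assoc', div_le_div_iff₀ hS0 (by norm_num)]
      nlinarith
    rw [Real.log_mul (by norm_num) hκ0.ne'] at hB
    have h3 := mul_le_mul_of_nonneg_left log_fourteen_le hκ0.le
    linarith
  have hlogS : 1 ≤ Real.log S := by
    rw [Real.le_log_iff_exp_le hS0]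
    linarith [Real.exp_one_lt_d9]
  have hlogS3 : Real.log S ≤ Real.log (1 + S ^ 3) := by
    refine Real.log_le_log hS0 ?_
    have := le_self_pow₀ (show 1 ≤ S by linarith) (show 3 ≠ 0 by norm_num)
    linarith
  have hBM' : B ≤ 70 * (κ₁ + κ * Real.log (1 + S ^ 3)) := by
    have h1 := mul_le_mul_of_nonneg_left hlogS3 hκ0.le
    have h2 := mul_le_mul_of_nonneg_left hlogS hκ0.le
    linarith
  -- The tangent of log at κ gives κ log S ≤ S + κ log κ − κ, so B, and with it 1 + 2h + 4S, is of
  -- order S.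
  have hBS : B ≤ 13 * S := by
    have h1 := log_le_div_add_log hS0 hκ0
    have h2 := mul_le_mul_of_nonneg_left h1 hκ0.le
    rw [mul_sub, mul_add, mul_div_cancel₀ _ hκ0.ne'] at h2
    linarith
  have h1 := pow_le_pow_left₀ h0 hh 3
  rw [mul_pow, rpow_third_pow_three (by positivity)] at h1
  have h2 : 1 + 2 * h + 4 * S ≤ 100000 * S := by linarith
  have h3 := mul_le_mul h2 (pow_le_pow_left₀ hB0.le hBM' 2) (sq_nonneg B) (by positivity)
  refine h1.trans ((mul_le_mul_of_nonneg_left h3 (by positivity)).trans ?_)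
  have h4 : 0 ≤ (κ₁ + κ * Real.log (1 + S ^ 3)) ^ 2 * S := by positivity
  calc _ = (80 ^ 3 * 100000 * 70 ^ 2) * ((κ₁ + κ * Real.log (1 + S ^ 3)) ^ 2 * S) := by ring
    _ ≤ _ := mul_le_mul_of_nonneg_right (by norm_num) h4

variable {d : ℕ} {Ξ : Type*} [MeasurableSpace Ξ] {f : EuclideanSpace ℝ (Fin d) → Ξ → ℝ}
  {μ : Measure Ξ} [IsProbabilityMeasure μ] {σ β G : ℝ}

namespace Assumptions

variable (hA : Assumptions f μ σ β G)
include hA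

theorem integral_sumSqGradient_rpow_pow_three_le (hσ : 0 < σ) (hβ : 0 ≤ β)
    (x₁ : EuclideanSpace ℝ (Fin d)) (n : ℕ) {S κ₁ : ℝ}
    (hκ₁ : κ₁ = kappa₁ (objective f μ x₁ - ⨅ x, objective f μ x) σ β G)
    (hS3 : S ^ 3 = σ ^ 2 * (n + 1 : ℕ)) (hS : 10 * (1 + κ₁) ≤ S) :
    (∫ w, sumSqGradient f μ x₁ n w ^ (1 / 3 : ℝ) ∂sampleLaw μ) ^ 3 ≤
      10 ^ 15 * ((κ₁ + kappa₂ β G * Real.log (1 + S ^ 3)) ^ 2 * S) := by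
  have hκ1 : 1 ≤ kappa₂ β G := one_le_kappa₂
  have hS0 : 0 < S := by
    have h : 0 < S ^ 3 := by rw [hS3]; positivity
    exact (Odd.pow_pos_iff (by decide)).1 h
  have hh0 : 0 ≤ ∫ w, sumSqGradient f μ x₁ n w ^ (1 / 3 : ℝ) ∂sampleLaw μ :=
    integral_nonneg fun w => Real.rpow_nonneg (sumSqGradient_nonneg x₁ n w) _
  have hU := hA.integral_root_sq_le hβ x₁ n hS0 hS3
  have hU0 : 0 < 1 + 2 * (∫ w, sumSqGradient f μ x₁ n w ^ (1 / 3 : ℝ) ∂sampleLaw μ) + 4 * S := by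
    positivity
  have hL := hA.integral_log_sumGrad_le x₁ n hU0 hU
  obtain ⟨hB1, hX, hY⟩ := hA.integral_moments_le hβ x₁ n rfl rfl
  have hB0 := (zero_lt_one.trans_le hκ1).trans_le hB1
  exact self_bounding_solution (sub_nonneg.2 (ciInf_le hA.bddBelow x₁)) hκ1 hκ₁ hS rfl hB0 hh0
    (hL.trans (add_le_add (Real.log_le_log (by positivity) one_add_sq_le_kappa₂) le_rfl))
    (hA.integral_sumSqGradient_rpow_le hβ x₁ n hU0 hB0 hU hX hY)

/-! ### From moments to probabilities. -/

/-- The set of sample sequences for which the gradient at the `i`-th iterate is large. -/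
theorem measurableSet_gradient_gt (hβ : 0 ≤ β) (x₁ : EuclideanSpace ℝ (Fin d)) (i : ℕ) (R : ℝ) :
    MeasurableSet {w | R < ‖gradient (objective f μ) (run (stochGrad f) x₁ w i).x‖} :=
  measurableSet_lt measurable_const ((hA.measurable_gradient hβ).comp
    (State.measurable_x.comp (hA.measurable_run x₁ i))).norm

/-- Markov's inequality for the cube root of the sum of squared gradients. -/
theorem sum_measureReal_gradient_gt_le (hβ : 0 ≤ β) (x₁ : EuclideanSpace ℝ (Fin d)) (n : ℕ)
    {R δ : ℝ} (hR : 0 < R) (hδ : 0 < δ)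
    (h : (∫ w, sumSqGradient f μ x₁ n w ^ (1 / 3 : ℝ) ∂sampleLaw μ) ^ 3 ≤
      δ ^ 3 * ((n + 1 : ℕ) * R ^ 2)) :
    ∑ i ∈ Finset.range (n + 1), (sampleLaw μ).real
      {w | R < ‖gradient (objective f μ) (run (stochGrad f) x₁ w i).x‖} ≤ δ * (n + 1 : ℕ) := by
  set T : ℝ := ((n + 1 : ℕ) : ℝ) with hT
  have hT0 : 0 < T := by positivity
  set c : ℝ := (T * R ^ 2) ^ (1 / 3 : ℝ) with hc
  have hc0 : 0 < c := by positivity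
  have hc3 : c ^ 3 = T * R ^ 2 := rpow_third_pow_three (by positivity)
  set A : ℕ → Set (ℕ → Ξ) := fun i =>
    {w | R < ‖gradient (objective f μ) (run (stochGrad f) x₁ w i).x‖} with hAdef
  have hA' : ∀ i, MeasurableSet (A i) := fun i => hA.measurableSet_gradient_gt hβ x₁ i R
  have hi : ∀ i, Integrable ((A i).indicator (1 : (ℕ → Ξ) → ℝ)) (sampleLaw μ) := fun i =>
    (integrable_const (1 : ℝ)).indicator (hA' i)
  -- The count N of large gradients satisfies N ≤ T and N R² ≤ H, so N / T ≤ (N / T)^(1/3) ≤ (H / (T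
  -- R²))^(1/3), where c³ = T R².
  have hle : ∀ w, ∑ i ∈ Finset.range (n + 1), (A i).indicator (1 : (ℕ → Ξ) → ℝ) w ≤
      T / c * sumSqGradient f μ x₁ n w ^ (1 / 3 : ℝ) := by
    intro w
    set N := ∑ i ∈ Finset.range (n + 1), (A i).indicator (1 : (ℕ → Ξ) → ℝ) w with hN
    have hN0 : 0 ≤ N := Finset.sum_nonneg fun i _ =>
      Set.indicator_nonneg (fun _ _ => zero_le_one) w
    have hNT : N ≤ T := by
      calc N ≤ ∑ i ∈ Finset.range (n + 1), (1 : ℝ) := Finset.sum_le_sum fun i _ =>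
            Set.indicator_le_self' (fun _ _ => zero_le_one) w
        _ = T := by simp [hT]
    have hNH : N * R ^ 2 ≤ sumSqGradient f μ x₁ n w := by
      rw [hN, sumSqGradient, Finset.sum_mul]
      refine Finset.sum_le_sum fun i _ => ?_
      by_cases hw : w ∈ A i
      · rw [Set.indicator_of_mem hw, Pi.one_apply, one_mul]
        exact pow_le_pow_left₀ hR.le (le_of_lt hw) 2
      · rw [Set.indicator_of_notMem hw, zero_mul]
        exact sq_nonneg _
    have hH0 := sumSqGradient_nonneg (f := f) (μ := μ) x₁ n w
    rw [div_mul_eq_mul_div, le_div_iff₀ hc0]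
    refine le_of_pow_le_pow_left₀ (n := 3) (by norm_num) (by positivity) ?_
    rw [mul_pow, mul_pow, hc3, rpow_third_pow_three hH0]
    have h1 := pow_le_pow_left₀ hN0 hNT 2
    calc N ^ 3 * (T * R ^ 2) = (N ^ 2 * T) * (N * R ^ 2) := by ring
      _ ≤ (T ^ 2 * T) * sumSqGradient f μ x₁ n w :=
        mul_le_mul (mul_le_mul_of_nonneg_right h1 hT0.le) hNH (by positivity) (by positivity)
      _ = _ := by ring
  have h1 := integral_mono (integrable_finsetSum _ fun i _ => hi i)
    ((hA.essBdd_sumSqGradient_rpow hβ x₁ n).const_mul (T / c)).integrable hle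
  rw [integral_finsetSum _ fun i _ => hi i, integral_const_mul] at h1
  simp only [integral_indicator_one (hA' _)] at h1
  refine h1.trans ?_
  have h2 : ∫ w, sumSqGradient f μ x₁ n w ^ (1 / 3 : ℝ) ∂sampleLaw μ ≤ δ * c := by
    refine le_of_pow_le_pow_left₀ (n := 3) (by norm_num) (by positivity) ?_
    rwa [mul_pow, hc3]
  refine (mul_le_mul_of_nonneg_left h2 (by positivity)).trans (le_of_eq ?_)
  field_simp

end Assumptions

/-- The probability of an event at an independent uniformly distributed time. -/
theorem measureReal_uniform_time_le {Ω 𝓧 : Type*} [MeasurableSpace Ω] [MeasurableSpace 𝓧]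
    {P : Measure Ω} [IsProbabilityMeasure P] {ν : Measure 𝓧} {τ : Ω → ℕ} {Ψ : Ω → 𝓧} {T : ℕ}
    (hτ : HasLaw τ (uniformOn (Finset.range T : Set ℕ)) P) (hΨ : HasLaw Ψ ν P)
    (hind : IndepFun τ Ψ P) {A : ℕ → Set 𝓧} (hA : ∀ i, MeasurableSet (A i)) :
    P.real {ω | Ψ ω ∈ A (τ ω)} ≤ (∑ i ∈ Finset.range T, ν.real (A i)) / T := by
  classical
  -- Almost surely τ is one of the T rounds, so the event splits over finitely many values of τ up
  -- to a null set.
  have h0 : P (τ ⁻¹' (Finset.range T : Set ℕ)ᶜ) = 0 := by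
    rw [← Measure.map_apply_of_aemeasurable hτ.aemeasurable (MeasurableSet.of_discrete),
      hτ.map_eq, uniformOn_eq_zero_iff (Finset.finite_toSet _)]
    exact Set.inter_compl_self _
  have h1 : ∀ i ∈ Finset.range T, P.real (τ ⁻¹' {i} ∩ Ψ ⁻¹' A i) = ν.real (A i) / T := by
    intro i hi
    have h2 : P (τ ⁻¹' {i}) = 1 / T := by
      rw [← Measure.map_apply_of_aemeasurable hτ.aemeasurable (measurableSet_singleton i),
        hτ.map_eq, ← Finset.coe_singleton, uniformOn_apply_finset,
        Finset.inter_singleton_of_mem hi]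
      simp
    have h3 : P (Ψ ⁻¹' A i) = ν (A i) := by
      rw [← Measure.map_apply_of_aemeasurable hΨ.aemeasurable (hA i), hΨ.map_eq]
    rw [measureReal_def, hind.measure_inter_preimage_eq_mul _ _ (measurableSet_singleton i) (hA i),
      h2, h3, ENNReal.toReal_mul, measureReal_def, ENNReal.toReal_div, ENNReal.toReal_one,
      ENNReal.toReal_natCast]
    ring
  have h2 : {ω | Ψ ω ∈ A (τ ω)} ⊆ τ ⁻¹' (Finset.range T : Set ℕ)ᶜ ∪
      ⋃ i ∈ Finset.range T, τ ⁻¹' {i} ∩ Ψ ⁻¹' A i := by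
    intro ω hω
    by_cases hT : τ ω ∈ Finset.range T
    · exact Or.inr (Set.mem_biUnion hT ⟨rfl, hω⟩)
    · exact Or.inl (by simpa using hT)
  calc P.real {ω | Ψ ω ∈ A (τ ω)}
      ≤ P.real (τ ⁻¹' (Finset.range T : Set ℕ)ᶜ) +
        P.real (⋃ i ∈ Finset.range T, τ ⁻¹' {i} ∩ Ψ ⁻¹' A i) :=
        (measureReal_mono h2).trans (measureReal_union_le _ _)
    _ ≤ 0 + ∑ i ∈ Finset.range T, P.real (τ ⁻¹' {i} ∩ Ψ ⁻¹' A i) := by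
        refine add_le_add (le_of_eq ?_) (measureReal_biUnion_finset_le _ _)
        rw [measureReal_def, h0, ENNReal.toReal_zero]
    _ = _ := by rw [zero_add, Finset.sum_congr rfl h1, Finset.sum_div]

/-- The term σ^(1/3) / T^(1/3) alone suffices, since T times its square is exactly S; and (10⁸)²
exceeds 10¹⁵. -/
theorem threshold_sq_ge {S M δ σ T R : ℝ} (hσ : 0 < σ) (hT : 0 < T) (hδ : 0 < δ) (hM : 0 ≤ M)
    (hS : S = (σ ^ 2 * T) ^ (1 / 3 : ℝ))
    (hR : R = 10 ^ 8 * (M / δ ^ (3 / 2 : ℝ)) *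
      (1 / T ^ (1 / 2 : ℝ) + σ ^ (1 / 3 : ℝ) / T ^ (1 / 3 : ℝ))) :
    10 ^ 15 * (M ^ 2 * S) ≤ δ ^ 3 * (T * R ^ 2) := by
  have h1 : 10 ^ 8 * (M / δ ^ (3 / 2 : ℝ)) * (σ ^ (1 / 3 : ℝ) / T ^ (1 / 3 : ℝ)) ≤ R := by
    rw [hR]
    refine mul_le_mul_of_nonneg_left ?_ (by positivity)
    exact le_add_of_nonneg_left (by positivity)
  have h2 := pow_le_pow_left₀ (by positivity) h1 2
  have hδ3 : (δ ^ (3 / 2 : ℝ)) ^ 2 = δ ^ 3 := by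
    rw [← Real.rpow_natCast, ← Real.rpow_mul hδ.le, ← Real.rpow_natCast]
    norm_num
  have hS' : S = (σ ^ (1 / 3 : ℝ)) ^ 2 * T ^ (1 / 3 : ℝ) := by
    rw [hS, Real.mul_rpow (by positivity) hT.le, ← Real.rpow_natCast, ← Real.rpow_mul hσ.le,
      ← Real.rpow_natCast, ← Real.rpow_mul hσ.le, mul_comm (1 / 3 : ℝ)]
  have hT3 := rpow_third_pow_three hT.le
  have h3 := mul_le_mul_of_nonneg_left h2 (show 0 ≤ δ ^ 3 * T by positivity)
  rw [mul_assoc] at h3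
  rw [← mul_assoc (δ ^ 3) T]
  refine le_trans ?_ h3
  have ht : 0 < T ^ (1 / 3 : ℝ) := by positivity
  have e1 : δ ^ 3 * (T * (10 ^ 8 * (M / δ ^ (3 / 2 : ℝ)) *
      (σ ^ (1 / 3 : ℝ) / T ^ (1 / 3 : ℝ))) ^ 2) = 10 ^ 16 * (M ^ 2 * S) := by
    rw [mul_pow, mul_pow, div_pow, div_pow, hδ3, hS']
    nth_rewrite 1 [← hT3]
    field_simp
  rw [e1]
  have hS0 : 0 ≤ M ^ 2 * S := by rw [hS]; positivity
  exact mul_le_mul_of_nonneg_right (by norm_num) hS0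

end

end MetaStorm

end

/-! ### The main theorem. -/

theorem corollary2 :
    ∃ C₀ > (0 : ℝ), ∃ C > (0 : ℝ),
      ∀ (d : ℕ) (Ξ : Type*) [MeasurableSpace Ξ] (μ : Measure Ξ) [IsProbabilityMeasure μ]
        (f : EuclideanSpace ℝ (Fin d) → Ξ → ℝ) (σ β G : ℝ),
        0 < σ → 0 ≤ β → 0 ≤ G → MetaStorm.Assumptions f μ σ β G →
      ∀ (x₁ : EuclideanSpace ℝ (Fin d)) (κ₁ κ₂ : ℝ),
        κ₂ = MetaStorm.kappa₂ β G →
        κ₁ = MetaStorm.kappa₁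
          (MetaStorm.objective f μ x₁ - ⨅ x, MetaStorm.objective f μ x) σ β G →
      ∀ T : ℕ, C₀ * (1 + κ₁) ≤ (σ ^ 2 * T) ^ (1 / 3 : ℝ) →
      -- independent samples and, independent of them, a uniformly distributed output round
      ∀ (Ω : Type*) [MeasurableSpace Ω] (P : Measure Ω) [IsProbabilityMeasure P]
        (ξ : ℕ → Ω → Ξ) (τ : Ω → ℕ),
        (∀ n, HasLaw (ξ n) μ P) → iIndepFun ξ P →
        HasLaw τ (uniformOn (Finset.range T : Set ℕ)) P →
        IndepFun τ (fun ω n => ξ n ω) P →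
      ∀ δ : ℝ, 0 < δ → δ < 1 →
        1 - δ ≤ P.real {ω |
          ‖gradient (MetaStorm.objective f μ)
            (MetaStorm.metaStormSG (MetaStorm.stochGrad f) 1 1 1 (1 / 2) (1 / 4) x₁
              (fun n => ξ n ω) (τ ω)).x‖
            ≤ C * ((κ₁ + κ₂ * Real.log (1 + σ ^ 2 * T)) / δ ^ (3 / 2 : ℝ))
              * (1 / (T : ℝ) ^ (1 / 2 : ℝ) + σ ^ (1 / 3 : ℝ) / (T : ℝ) ^ (1 / 3 : ℝ))} := by
  refine ⟨10, by norm_num, 10 ^ 8, by norm_num, ?_⟩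
  intro d Ξ _ μ _ f σ β G hσ hβ _ hA x₁ κ₁ κ₂ hκ₂ hκ₁ T hT Ω _ P _ ξ τ hξ hindep hτ hτξ δ hδ _
  have hκ1 : 1 ≤ κ₂ := hκ₂ ▸ MetaStorm.one_le_kappa₂
  have hκ₁0 : 0 ≤ κ₁ := by
    rw [hκ₁, MetaStorm.kappa₁, ← hκ₂]
    have h1 := sub_nonneg.2 (ciInf_le hA.bddBelow x₁)
    have h2 := mul_nonneg (zero_le_one.trans hκ1) (Real.log_nonneg hκ1)
    have h3 := sq_nonneg σ
    have h4 := sq_nonneg G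
    linarith
  -- For T = 0 the largeness condition would bound the positive number 10 (1 + κ₁) by zero.
  obtain ⟨n, rfl⟩ : ∃ n, T = n + 1 := by
    refine Nat.exists_eq_succ_of_ne_zero fun h0 => ?_
    rw [h0, Nat.cast_zero, mul_zero, Real.zero_rpow (by norm_num)] at hT
    linarith
  set S : ℝ := (σ ^ 2 * (n + 1 : ℕ)) ^ (1 / 3 : ℝ) with hS
  have hS3 : S ^ 3 = σ ^ 2 * (n + 1 : ℕ) := MetaStorm.rpow_third_pow_three (by positivity)
  have hTpos : (0 : ℝ) < (n + 1 : ℕ) := by positivity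
  have hlog : 0 < Real.log (1 + σ ^ 2 * (n + 1 : ℕ)) :=
    Real.log_pos (lt_add_of_pos_right _ (by positivity))
  have hM : 0 < κ₁ + κ₂ * Real.log (1 + σ ^ 2 * (n + 1 : ℕ)) :=
    add_pos_of_nonneg_of_pos hκ₁0 (mul_pos (by linarith) hlog)
  have h1 := hA.integral_sumSqGradient_rpow_pow_three_le hσ hβ x₁ n hκ₁ hS3 hT
  rw [hS3, ← hκ₂] at h1
  set R := 10 ^ 8 * ((κ₁ + κ₂ * Real.log (1 + σ ^ 2 * (n + 1 : ℕ))) / δ ^ (3 / 2 : ℝ)) *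
    (1 / ((n + 1 : ℕ) : ℝ) ^ (1 / 2 : ℝ) + σ ^ (1 / 3 : ℝ) / ((n + 1 : ℕ) : ℝ) ^ (1 / 3 : ℝ))
    with hR
  have hR0 : 0 < R := by positivity
  have h2 := h1.trans (MetaStorm.threshold_sq_ge hσ hTpos hδ hM.le hS hR)
  have h3 := hA.sum_measureReal_gradient_gt_le hβ x₁ n hR0 hδ h2
  have hlaw : HasLaw (fun ω i => ξ i ω) (MetaStorm.sampleLaw μ) P :=
    hindep.hasLaw_infinitePi hξ (aemeasurable_pi_lambda _ fun i => (hξ i).aemeasurable)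
  have h4 := MetaStorm.measureReal_uniform_time_le hτ hlaw hτξ
    fun i => hA.measurableSet_gradient_gt hβ x₁ i R
  have h5 := h4.trans ((div_le_iff₀ hTpos).2 h3)
  -- The event and its complement cover Ω, so subadditivity suffices and the event need not be
  -- measurable.
  have h6 := measureReal_union_le (μ := P)
    {ω | ‖gradient (MetaStorm.objective f μ)
      (MetaStorm.run (MetaStorm.stochGrad f) x₁ (fun i => ξ i ω) (τ ω)).x‖ ≤ R}
    {ω | R < ‖gradient (MetaStorm.objective f μ)
      (MetaStorm.run (MetaStorm.stochGrad f) x₁ (fun i => ξ i ω) (τ ω)).x‖}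
  have h7 : {ω | ‖gradient (MetaStorm.objective f μ)
      (MetaStorm.run (MetaStorm.stochGrad f) x₁ (fun i => ξ i ω) (τ ω)).x‖ ≤ R} ∪
    {ω | R < ‖gradient (MetaStorm.objective f μ)
      (MetaStorm.run (MetaStorm.stochGrad f) x₁ (fun i => ξ i ω) (τ ω)).x‖} = Set.univ :=
    Set.eq_univ_of_forall fun ω => by
      simp only [Set.mem_union, Set.mem_ofPred_eq]
      exact le_or_gt _ _
  rw [h7, probReal_univ] at h6
  simp only [Set.mem_ofPred_eq] at h5
  exact sub_le_iff_le_add.2 (h6.trans (add_le_add le_rfl h5))
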